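/- Let $n\ge 0$ and let $W_0,W_1$ be closed (compact, without boundary) smooth $n$-manifolds, any of which may be empty or disconnected. Let $(M,V_0,V_1,d_0,d_1)$ be a topological cobordism from $W_0$ to $W_1$: $M$ is a compact smooth $(n+1)$-manifold with boundary, $\partial M$ is the disjoint union of the two closed submanifolds $V_0$ and $V_1$, and $d_i\colon V_i\to W_i$ is a diffeomorphism for $i=0,1$. Let $h_0,h_1$ be (smooth) Riemannian metrics on $W_0,W_1$, and let $\zeta>1$ be a real number. Then there exist a Morse function $f\colon M\to[0,1]$ (a smooth function with only finitely many critical points, at each of which the Hessian is nondegenerate) with $f^{-1}(0)=V_0$, $f^{-1}(1)=V_1$ and no critical points on $\partial M$, and a smooth Riemannian metric $G$ on $M$, such that the Morse metric $$g=|df|_G^2\,G-\zeta\,df\otimes df,\qquad |df|_G^2=G^{\rho\sigma}\,\partial_\rho f\,\partial_\sigma f,$$ satisfies $$(d_i^{-1})^*\bigl(g|_{V_i}\bigr)=h_i,\qquad i=0,1,$$ where $g|_{V_i}$ is the pullback of $g$ under the inclusion $V_i\hookrightarrow M$. Moreover, at every point of $M$ that is not a critical point of $f$, the symmetric bilinear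 form $g$ has Lorentzian signature $(-,+,\dots,+)$, and the gradient $G^{\mu\nu}\partial_\nu f$ is timelike, i.e. $g(\operatorname{grad}_G f,\operatorname{grad}_G f)<0$. -/

import Mathlib

open Set
open scoped Manifold ContDiff

noncomputable section

namespace MorseCobordism

section General

variable {E : Type*} [NormedAddCommGroup E] [NormedSpace ℝ E]
  {H : Type*} [TopologicalSpace H] (I : ModelWithCorners ℝ E H)
  {M : Type*} [TopologicalSpace M] [ChartedSpace H M]

/-- A field of bilinear forms on the tangent spaces of `M` (a covariant 2-tensor field). -/
abbrev TensorField₂ (M : Type*) [TopologicalSpace M] [ChartedSpace H M] :=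
  ∀ x : M, LinearMap.BilinForm ℝ (TangentSpace I x)

/-- The smooth Riemannian metrics on a manifold. -/
abbrev RiemMetric (M : Type*) [TopologicalSpace M] [ChartedSpace H M] [IsManifold I ∞ M] :=
  Bundle.ContMDiffRiemannianMetric I ∞ E (fun x : M ↦ TangentSpace I x)

/-- The 2-tensor field underlying a Riemannian metric. -/
def RiemMetric.toTensor {I : ModelWithCorners ℝ E H} [IsManifold I ∞ M]
    (G : RiemMetric I M) : TensorField₂ I M := fun x ↦
  LinearMap.mk₂ ℝ (fun v w ↦ G.inner x v w) (by simp) (by simp) (by simp) (by simp)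

/-- The pullback `φ^* g` of a 2-tensor field along a map `φ : N → M`. -/
def pullback {E' : Type*} [NormedAddCommGroup E'] [NormedSpace ℝ E']
    {H' : Type*} [TopologicalSpace H'] (J : ModelWithCorners ℝ E' H')
    {N : Type*} [TopologicalSpace N] [ChartedSpace H' N]
    (φ : N → M) (g : TensorField₂ I M) : TensorField₂ J N := fun y ↦
  (g (φ y)).comp (mfderiv J I φ y).toLinearMap (mfderiv J I φ y).toLinearMap

/-- `x` is a critical point of `f`: the differential `df` vanishes at `x`. -/
def IsCritPt (f : M → ℝ) (x : M) : Prop := mvfderiv I f x = 0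

/-- The matrix of second partial derivatives of `f` at `x`, as a bilinear form, computed in the
preferred chart at `x` (where `range I` is all of `E`, or a half-space if `M` has a boundary).
It is used at critical points only, where its nondegeneracy does not depend on the chart. -/
def hessian (f : M → ℝ) (x : M) : E →L[ℝ] E →L[ℝ] ℝ :=
  fderivWithin ℝ (fderivWithin ℝ (f ∘ (extChartAt I x).symm) (range I)) (range I)
    (extChartAt I x x)

/-- Morse functions: smooth functions with finitely many critical points, all nondegenerate. -/
structure IsMorse (f : M → ℝ) : Prop where
  smooth : ContMDiff I 𝓘(ℝ, ℝ) ∞ f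
  finite : {x : M | IsCritPt I f x}.Finite
  nondegenerate : ∀ x, IsCritPt I f x → ∀ v, (∀ w, hessian I f x v w = 0) → v = 0

/-- A symmetric bilinear form of Lorentzian signature `(-, +, ..., +)`: it is negative on some
vector and positive definite on the orthogonal complement of that vector. -/
def IsLorentzian {T : Type*} [AddCommGroup T] [Module ℝ T] (B : LinearMap.BilinForm ℝ T) : Prop :=
  B.IsSymm ∧ ∃ v, B v v < 0 ∧ ∀ w, B v w = 0 → w ≠ 0 → 0 < B w w

section Metric

variable {I} [IsManifold I ∞ M]

theorem RiemMetric.nondegenerate (G : RiemMetric I M) (x : M) : (G.toTensor x).Nondegenerate := by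
  have key : ∀ v, G.toTensor x v v = 0 → v = 0 := by
    intro v hv
    by_contra h
    exact (G.pos x v h).ne' hv
  exact ⟨fun v hv ↦ key v (hv v), fun v hv ↦ key v (hv v)⟩

variable [FiniteDimensional ℝ E]

instance (x : M) : FiniteDimensional ℝ (TangentSpace I x) :=
  inferInstanceAs (FiniteDimensional ℝ E)

/-- The gradient `G^{μν} ∂_ν f`: the vector with `G (grad f, w) = df (w)` for all `w`. -/
def grad (G : RiemMetric I M) (f : M → ℝ) (x : M) : TangentSpace I x :=
  ((G.toTensor x).toDual (G.nondegenerate x)).symm (mvfderiv I f x).toLinearMap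

theorem toTensor_grad (G : RiemMetric I M) (f : M → ℝ) (x : M) (w : TangentSpace I x) :
    G.toTensor x (grad G f x) w = mvfderiv I f x w := by
  rw [← LinearMap.BilinForm.toDual_def (G.nondegenerate x), grad, LinearEquiv.apply_symm_apply]
  rfl

/-- The squared norm of the differential, `|df|_G^2 = G^{ρσ} ∂_ρ f ∂_σ f`. -/
def dfSq (G : RiemMetric I M) (f : M → ℝ) (x : M) : ℝ := mvfderiv I f x (grad G f x)

/-- The tensor field `g = |df|_G^2 G - ζ df ⊗ df`. -/
def morseMetric (f : M → ℝ) (G : RiemMetric I M) (ζ : ℝ) : TensorField₂ I M := fun x ↦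
  dfSq G f x • G.toTensor x - ζ • LinearMap.BilinForm.linMulLin
    (mvfderiv I f x).toLinearMap (mvfderiv I f x).toLinearMap

end Metric

end General

section Triad

variable (n : ℕ) {M : Type*} [TopologicalSpace M] [ChartedSpace (EuclideanHalfSpace (n + 1)) M]
  (V₀ V₁ : Set M)
  [ChartedSpace (EuclideanSpace ℝ (Fin n)) V₀] [ChartedSpace (EuclideanSpace ℝ (Fin n)) V₁]

/-- The boundary of the `(n + 1)`-manifold `M` is the disjoint union of the closed subsets `V₀`
and `V₁`, and their manifold structures are those of embedded submanifolds of `M`. -/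
structure IsTriad : Prop where
  isClosed₀ : IsClosed V₀
  isClosed₁ : IsClosed V₁
  disjoint : Disjoint V₀ V₁
  boundary_eq : (𝓡∂ (n + 1)).boundary M = V₀ ∪ V₁
  embedding₀ : Manifold.IsSmoothEmbedding (𝓡 n) (𝓡∂ (n + 1)) ∞ (Subtype.val : V₀ → M)
  embedding₁ : Manifold.IsSmoothEmbedding (𝓡 n) (𝓡∂ (n + 1)) ∞ (Subtype.val : V₁ → M)

/-- A Morse function `f : M → [0, 1]` on a triad: `f⁻¹(0) = V₀`, `f⁻¹(1) = V₁`, and there are no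
critical points on the boundary. -/
structure IsTriadMorse (n : ℕ) {M : Type*} [TopologicalSpace M]
    [ChartedSpace (EuclideanHalfSpace (n + 1)) M] (V₀ V₁ : Set M) (f : M → ℝ) : Prop where
  isMorse : IsMorse (𝓡∂ (n + 1)) f
  mem_Icc : ∀ x, f x ∈ Icc (0 : ℝ) 1
  preimage_zero : f ⁻¹' {0} = V₀
  preimage_one : f ⁻¹' {1} = V₁
  boundary_regular : ∀ x ∈ (𝓡∂ (n + 1)).boundary M, ¬ IsCritPt (𝓡∂ (n + 1)) f x

end Triad

end MorseCobordism

end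

/-! The boundary condition decouples. Since `f` is constant on each `Vᵢ`, `df` kills the vectors
tangent to `Vᵢ`, and on them the Morse metric is just `|df|² G`. It therefore suffices that `G`
restricts to `dᵢ^* hᵢ` on `Vᵢ` and that `|df|_G = 1` on the boundary.

The first condition is affine in `G`, so a partition of unity glues local solutions
(`exists_metric_restrictsTo`); near a boundary point a local solution is `(d ∘ r)^* h + dξ ⊗ dξ`,
with `r` a retraction onto the boundary and `ξ` the coordinate normal to it. For the second, take a
vector field `ν` with `df(ν) = 1` on the boundary and replace `G` by `G(v - df(v) ν, w - df(w) ν) +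
df(v) df(w)`. This leaves `G` unchanged on `ker df` and makes `ν` the gradient wherever `df(ν) = 1`
(`exists_metric_unit_differential`).

The signature is pointwise algebra: with `X = grad f` and `c = |df|²`, one has `g(X, w) = c (1 - ζ)
df(w)`. Hence `g(X, X) = c² (1 - ζ) < 0`, and the orthogonal complement of `X` is `ker df`, where `g
= c G` is positive (`morseMetric_isLorentzian`).

The Morse function starts from a function with the right boundary behaviour, built from a boundary
defining function (`exists_boundary_regular_function`). It is then perturbed by small linear
functions in interior charts (`exists_isMorse_perturbation`): the easy case of Sard's theorem makes
the good parameters dense, and compactness makes them open. -/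

namespace MorseCobordism

open Bundle Filter Topology

/-! ### Smoothness of tensor fields, tested on vector fields -/

section Smoothness

variable {E : Type*} [NormedAddCommGroup E] [NormedSpace ℝ E]
  {H : Type*} [TopologicalSpace H] {I : ModelWithCorners ℝ E H}
  {M : Type*} [TopologicalSpace M] [ChartedSpace H M]
  {F : Type*} [NormedAddCommGroup F] [NormedSpace ℝ F]

/-- A family of continuous linear maps on a finite-dimensional space is smooth if all its
evaluations are. -/
theorem contMDiffAt_clm_of_apply {E' : Type*} [NormedAddCommGroup E'] [NormedSpace ℝ E']
    [FiniteDimensional ℝ E'] {L : M → E' →L[ℝ] F} {x₀ : M} {k : ℕ∞ω}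
    (h : ∀ v, ContMDiffAt I 𝓘(ℝ, F) k (fun x ↦ L x v) x₀) :
    ContMDiffAt I 𝓘(ℝ, E' →L[ℝ] F) k L x₀ := by
  let d := Module.finrank ℝ E'
  have hd : d = Module.finrank ℝ (Fin d → ℝ) := (Module.finrank_fin_fun ℝ).symm
  let e₁ := ContinuousLinearEquiv.ofFinrankEq hd
  let e₂ := (e₁.arrowCongr (1 : F ≃L[ℝ] F)).trans (ContinuousLinearEquiv.piRing (Fin d))
  have : L = e₂.symm ∘ (fun x ↦ e₂ (L x)) := by ext; simp
  rw [this]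
  exact e₂.symm.contDiff.contMDiff.contMDiffAt.comp x₀ (contMDiffAt_pi_space.2 fun i ↦ h _)

/-- The value of a smooth Riemannian metric, at a moving point, on smooth fields of vectors. -/
theorem contMDiffAt_metric_apply {E' : Type*} [NormedAddCommGroup E'] [NormedSpace ℝ E']
    {H' : Type*} [TopologicalSpace H'] {I' : ModelWithCorners ℝ E' H'}
    {N : Type*} [TopologicalSpace N] [ChartedSpace H' N] [IsManifold I' ∞ N]
    {h : ∀ y : N, TangentSpace I' y →L[ℝ] TangentSpace I' y →L[ℝ] ℝ} {f : M → N}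
    {v w : ∀ x : M, TangentSpace I' (f x)} {x₀ : M}
    (hh : ContMDiffAt I' (I'.prod 𝓘(ℝ, E' →L[ℝ] E' →L[ℝ] ℝ)) ∞
      (fun x ↦ TotalSpace.mk' (E' →L[ℝ] E' →L[ℝ] ℝ)
        (E := fun x : N ↦ TangentSpace I' x →L[ℝ] TangentSpace I' x →L[ℝ] ℝ) x (h x)) (f x₀))
    (hf : ContMDiffAt I I' ∞ f x₀)
    (hv : ContMDiffAt I (I'.prod 𝓘(ℝ, E')) ∞ (fun x ↦ TotalSpace.mk' E' (f x) (v x)) x₀)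
    (hw : ContMDiffAt I (I'.prod 𝓘(ℝ, E')) ∞ (fun x ↦ TotalSpace.mk' E' (f x) (w x)) x₀) :
    ContMDiffAt I 𝓘(ℝ, ℝ) ∞ (fun x ↦ h (f x) (v x) (w x)) x₀ := by
  have h1 := ContMDiffAt.clm_bundle_apply₂ (F₃ := ℝ) (E₃ := fun _ : N ↦ ℝ) (b := f)
    (ψ := fun x ↦ h (f x)) (hh.comp x₀ hf) hv hw
  rw [contMDiffAt_totalSpace] at h1
  simpa using h1.2

variable [IsManifold I ∞ M]

/-- The differential of a smooth function, applied to a smooth vector field, is smooth. -/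
theorem contMDiffAt_mvfderiv_apply {f : M → F} {v : ∀ x : M, TangentSpace I x} {x₀ : M}
    (hf : ContMDiffAt I 𝓘(ℝ, F) ∞ f x₀)
    (hv : ContMDiffAt I (I.prod 𝓘(ℝ, E)) ∞ (fun x ↦ TotalSpace.mk' E x (v x)) x₀) :
    ContMDiffAt I 𝓘(ℝ, F) ∞ (fun x ↦ mvfderiv I f x (v x)) x₀ := by
  have h1 := hf.mfderiv_const (m := ∞) (by simp)
  have h2 := ContMDiffAt.clm_apply_of_inCoordinates (b₁ := id) (b₂ := f)
    (ϕ := fun x ↦ mfderiv I 𝓘(ℝ, F) f x) h1 hv hf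
  rw [contMDiffAt_totalSpace] at h2
  have h3 := h2.2
  simp only [trivializationAt_model_space_apply] at h3
  exact h3

/-- The differential of a smooth map, applied to a smooth vector field, is smooth. -/
theorem contMDiffAt_mfderiv_apply {E' : Type*} [NormedAddCommGroup E'] [NormedSpace ℝ E']
    {H' : Type*} [TopologicalSpace H'] {I' : ModelWithCorners ℝ E' H'}
    {N : Type*} [TopologicalSpace N] [ChartedSpace H' N] [IsManifold I' ∞ N]
    {f : M → N} {v : ∀ x : M, TangentSpace I x} {x₀ : M}
    (hf : ContMDiffAt I I' ∞ f x₀)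
    (hv : ContMDiffAt I (I.prod 𝓘(ℝ, E)) ∞ (fun x ↦ TotalSpace.mk' E x (v x)) x₀) :
    ContMDiffAt I (I'.prod 𝓘(ℝ, E')) ∞
      (fun x ↦ TotalSpace.mk' E' (E := fun y : N ↦ TangentSpace I' y) (f x)
        (mfderiv I I' f x (v x))) x₀ :=
  ContMDiffAt.clm_apply_of_inCoordinates (b₁ := id) (b₂ := f)
    (ϕ := fun x ↦ mfderiv I I' f x) (hf.mfderiv_const (m := ∞) (by simp)) hv hf

/-- The constant vector fields of a trivialization are smooth on its base set. -/
theorem contMDiffAt_symmL_trivializationAt (x₀ : M) (e : E) {x : M}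
    (hx : x ∈ (trivializationAt E (TangentSpace I : M → Type _) x₀).baseSet) :
    ContMDiffAt I (I.prod 𝓘(ℝ, E)) ∞ (fun x ↦ TotalSpace.mk' E x
      ((trivializationAt E (TangentSpace I : M → Type _) x₀).symmL ℝ x e)) x := by
  rw [(trivializationAt E (TangentSpace I : M → Type _) x₀).contMDiffAt_section_iff hx]
  refine (contMDiffAt_const (c := e)).congr_of_eventuallyEq ?_
  filter_upwards [(trivializationAt E (TangentSpace I : M → Type _) x₀).open_baseSet.mem_nhds hx]
    with y hy
  rw [Trivialization.symmL_apply _ hy, Trivialization.apply_mk_symm _ hy]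

/-- A field of bilinear forms is smooth if its values on smooth vector fields are. -/
theorem contMDiffAt_bilin_of_apply [FiniteDimensional ℝ E]
    {B : ∀ x : M, TangentSpace I x →L[ℝ] TangentSpace I x →L[ℝ] ℝ} {x₀ : M}
    (h : ∀ v w : ∀ x : M, TangentSpace I x,
      ContMDiffAt I (I.prod 𝓘(ℝ, E)) ∞ (fun x ↦ TotalSpace.mk' E x (v x)) x₀ →
      ContMDiffAt I (I.prod 𝓘(ℝ, E)) ∞ (fun x ↦ TotalSpace.mk' E x (w x)) x₀ →
      ContMDiffAt I 𝓘(ℝ, ℝ) ∞ (fun x ↦ B x (v x) (w x)) x₀) :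
    ContMDiffAt I (I.prod 𝓘(ℝ, E →L[ℝ] E →L[ℝ] ℝ)) ∞
      (fun x ↦ TotalSpace.mk' (E →L[ℝ] E →L[ℝ] ℝ)
        (E := fun x : M ↦ TangentSpace I x →L[ℝ] TangentSpace I x →L[ℝ] ℝ) x (B x)) x₀ := by
  refine (contMDiffAt_hom_bundle _).2 ⟨contMDiffAt_id, ?_⟩
  -- The entries of `B` in the trivialization are its values on the constant fields of that
  -- trivialization.
  refine contMDiffAt_clm_of_apply fun e ↦ contMDiffAt_clm_of_apply fun e' ↦ ?_
  have hx₀ := FiberBundle.mem_baseSet_trivializationAt' (F := E)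
    (E := (TangentSpace I : M → Type _)) x₀
  refine (h _ _ (contMDiffAt_symmL_trivializationAt x₀ e hx₀)
    (contMDiffAt_symmL_trivializationAt x₀ e' hx₀)).congr_of_eventuallyEq ?_
  filter_upwards [(trivializationAt E (TangentSpace I : M → Type _) x₀).open_baseSet.mem_nhds hx₀]
    with y hy
  rw [inCoordinates_apply_eq₂ hy hy (by simp)]
  simp [Trivialization.symmL_apply _ hy]

end Smoothness

/-! ### Boundary charts and the local retraction onto the boundary -/

section HalfSpace

variable {n : ℕ} {M : Type*} [TopologicalSpace M] [ChartedSpace (EuclideanHalfSpace (n + 1)) M]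

theorem extChartAt_zero_nonneg (c y : M) : 0 ≤ (extChartAt (𝓡∂ (n + 1)) c y) 0 :=
  (chartAt (EuclideanHalfSpace (n + 1)) c y).2

theorem mem_range_halfSpace {y : EuclideanSpace ℝ (Fin (n + 1))} :
    y ∈ range (𝓡∂ (n + 1)) ↔ 0 ≤ y 0 := by
  rw [range_modelWithCornersEuclideanHalfSpace]; rfl

variable [IsManifold (𝓡∂ (n + 1)) ∞ M]

/-- Interior points can be recognized in any chart of the atlas, and the interior of the half-space
is where the first coordinate is positive. -/
theorem mem_boundary_iff {c y : M} (hy : y ∈ (chartAt (EuclideanHalfSpace (n + 1)) c).source) :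
    y ∈ (𝓡∂ (n + 1)).boundary M ↔ (extChartAt (𝓡∂ (n + 1)) c y) 0 = 0 := by
  have h1 := (𝓡∂ (n + 1)).isInteriorPoint_iff_of_mem_atlas (n := ∞) (by simp)
    (chart_mem_atlas (EuclideanHalfSpace (n + 1)) c) hy
  have h2 : (extChartAt (𝓡∂ (n + 1)) c) y ∈ interior (extChartAt (𝓡∂ (n + 1)) c).target ↔
      0 < (extChartAt (𝓡∂ (n + 1)) c y) 0 := by
    have h3 := interior_range_modelWithCornersEuclideanHalfSpace (n + 1)
    constructor
    · intro h
      have := interior_mono (extChartAt_target_subset_range (I := 𝓡∂ (n + 1)) c) h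
      rwa [h3] at this
    · intro h
      refine (chartAt (EuclideanHalfSpace (n + 1)) c).mem_interior_extend_target
        ((chartAt _ c).map_source hy) ?_
      rw [h3]
      exact h
  have h4 : y ∈ (𝓡∂ (n + 1)).boundary M ↔ ¬ (𝓡∂ (n + 1)).IsInteriorPoint y :=
    (𝓡∂ (n + 1)).isBoundaryPoint_iff_not_isInteriorPoint y
  rw [h4, h1]
  change ¬ (extChartAt (𝓡∂ (n + 1)) c y ∈ interior (extChartAt (𝓡∂ (n + 1)) c).target) ↔ _
  rw [h2]
  have := extChartAt_zero_nonneg (n := n) c y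
  constructor
  · intro h; linarith
  · intro h; linarith

variable (n) in
/-- The orthogonal projection onto the hyperplane bounding the half-space. -/
noncomputable def wallProj :
    EuclideanSpace ℝ (Fin (n + 1)) →L[ℝ] EuclideanSpace ℝ (Fin (n + 1)) :=
  ContinuousLinearMap.id ℝ _ -
    (EuclideanSpace.proj (0 : Fin (n + 1)) : EuclideanSpace ℝ (Fin (n + 1)) →L[ℝ] ℝ).smulRight
      (EuclideanSpace.single 0 1)

theorem wallProj_apply (y : EuclideanSpace ℝ (Fin (n + 1))) :
    wallProj n y = y - y 0 • EuclideanSpace.single 0 1 := by simp [wallProj]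

theorem wallProj_apply_zero (y : EuclideanSpace ℝ (Fin (n + 1))) : wallProj n y 0 = 0 := by
  simp [wallProj_apply]

theorem wallProj_eq_self {y : EuclideanSpace ℝ (Fin (n + 1))} (h : y 0 = 0) :
    wallProj n y = y := by simp [wallProj_apply, h]

/-- Near a point of a part `V` of the boundary, there is a smooth retraction onto `V`. -/
theorem exists_smooth_retraction {V : Set M} [ChartedSpace (EuclideanSpace ℝ (Fin n)) V]
    [IsManifold (𝓡 n) ∞ V]
    (hV : Manifold.IsSmoothEmbedding (𝓡 n) (𝓡∂ (n + 1)) ∞ (Subtype.val : V → M))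
    (hVb : V ⊆ (𝓡∂ (n + 1)).boundary M) {x₀ : M} (hx₀ : x₀ ∈ V)
    (hloc : ∀ᶠ y in 𝓝 x₀, y ∈ (𝓡∂ (n + 1)).boundary M → y ∈ V) :
    ∃ (r : M → V) (U : Set M), IsOpen U ∧ x₀ ∈ U ∧
      U ⊆ (chartAt (EuclideanHalfSpace (n + 1)) x₀).source ∧
      ContMDiffOn (𝓡∂ (n + 1)) (𝓡 n) ∞ r U ∧
      (∀ y ∈ U, ∀ hy : y ∈ V, r y = ⟨y, hy⟩) ∧
      ∀ y ∈ U, (r y : M) ∈ (chartAt (EuclideanHalfSpace (n + 1)) x₀).source ∧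
        extChartAt (𝓡∂ (n + 1)) x₀ (r y) = wallProj n (extChartAt (𝓡∂ (n + 1)) x₀ y) := by
  classical
  set φ := extChartAt (𝓡∂ (n + 1)) x₀ with hφ
  have hsrc : ∀ᶠ y in 𝓝 x₀, y ∈ (chartAt (EuclideanHalfSpace (n + 1)) x₀).source :=
    (chartAt _ x₀).open_source.mem_nhds (mem_chart_source _ x₀)
  have h0 : wallProj n (φ x₀) = φ x₀ :=
    wallProj_eq_self ((mem_boundary_iff (mem_chart_source _ x₀)).1 (hVb hx₀))
  have hcont : ContinuousAt (fun y ↦ wallProj n (φ y)) x₀ :=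
    (wallProj n).continuous.continuousAt.comp (continuousAt_extChartAt x₀)
  -- The projection fixes `φ x₀` and always lands in the half-space, so near `x₀` its values stay in
  -- the target of the chart.
  have htend : Tendsto (fun y ↦ wallProj n (φ y)) (𝓝 x₀) (𝓝[range (𝓡∂ (n + 1))] (φ x₀)) := by
    refine tendsto_nhdsWithin_iff.2 ⟨?_, Eventually.of_forall fun y ↦ ?_⟩
    · have := hcont.tendsto
      rwa [h0] at this
    · exact mem_range_halfSpace.2 (wallProj_apply_zero _).ge
  have htgt : ∀ᶠ y in 𝓝 x₀, wallProj n (φ y) ∈ φ.target :=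
    htend (extChartAt_target_mem_nhdsWithin x₀)
  have hr : ∀ᶠ y in 𝓝 x₀, (φ.symm (wallProj n (φ y)) ∈ (𝓡∂ (n + 1)).boundary M →
      φ.symm (wallProj n (φ y)) ∈ V) := by
    have : Tendsto (fun y ↦ φ.symm (wallProj n (φ y))) (𝓝 x₀) (𝓝 x₀) := by
      have h1 := (continuousAt_extChartAt_symm (I := 𝓡∂ (n + 1)) x₀).tendsto
      rw [extChartAt_to_inv] at h1
      exact h1.comp (htend.mono_right nhdsWithin_le_nhds)
    exact this hloc
  obtain ⟨U, hU, hUo, hxU⟩ := mem_nhds_iff.1 (hsrc.and (htgt.and hr))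
  have hφV : ∀ y ∈ U, φ.symm (wallProj n (φ y)) ∈ V := by
    intro y hy
    obtain ⟨-, h2, h3⟩ := hU hy
    have h4 : φ.symm (wallProj n (φ y)) ∈ (chartAt (EuclideanHalfSpace (n + 1)) x₀).source := by
      rw [← extChartAt_source (𝓡∂ (n + 1))]; exact φ.map_target h2
    refine h3 ((mem_boundary_iff h4).2 ?_)
    rw [← hφ, φ.right_inv h2, wallProj_apply_zero]
  have hsm : ContMDiffOn (𝓡∂ (n + 1)) (𝓡∂ (n + 1)) ∞ (fun y ↦ φ.symm (wallProj n (φ y))) U := by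
    refine (contMDiffOn_extChartAt_symm x₀).comp (t := φ.target) ?_ fun y hy ↦ (hU hy).2.1
    exact (wallProj n).contDiff.contMDiff.comp_contMDiffOn
      ((contMDiffOn_extChartAt (x := x₀)).mono fun y hy ↦ (hU hy).1)
  let r : M → V := fun y ↦ if h : φ.symm (wallProj n (φ y)) ∈ V then ⟨_, h⟩ else ⟨x₀, hx₀⟩
  have hrval : ∀ y ∈ U, (r y : M) = φ.symm (wallProj n (φ y)) := by
    intro y hy
    simp [r, hφV y hy]
  refine ⟨r, U, hUo, hxU, fun y hy ↦ (hU hy).1, ?_, ?_, ?_⟩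
  · intro y hy
    have hev : (Subtype.val ∘ r) =ᶠ[𝓝 y] fun y ↦ φ.symm (wallProj n (φ y)) :=
      Filter.eventuallyEq_of_mem (hUo.mem_nhds hy) hrval
    have h1 : ContMDiffAt (𝓡∂ (n + 1)) (𝓡∂ (n + 1)) ∞ (Subtype.val ∘ r) y :=
      (hsm.contMDiffAt (hUo.mem_nhds hy)).congr_of_eventuallyEq hev
    -- The inclusion of `V` is an immersion and `V` has the induced topology, so smoothness of `r`
    -- into `V` follows from smoothness of `r` into `M`.
    refine ((ContMDiffAt.iff_comp_isImmersionAt (hV.isImmersion.isImmersionAt (r y))).2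
      ⟨?_, h1⟩).contMDiffWithinAt
    exact IsInducing.subtypeVal.continuousAt_iff.2 h1.continuousAt
  · intro y hy hyV
    have h1 : φ y 0 = 0 := (mem_boundary_iff (hU hy).1).1 (hVb hyV)
    apply Subtype.ext
    rw [hrval y hy, wallProj_eq_self h1]
    exact φ.left_inv (by rw [hφ, extChartAt_source]; exact (hU hy).1)
  · intro y hy
    rw [hrval y hy]
    refine ⟨?_, φ.right_inv (hU hy).2.1⟩
    rw [← extChartAt_source (𝓡∂ (n + 1))]; exact φ.map_target (hU hy).2.1

end HalfSpace

/-! ### Positive definite forms in finite dimension -/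

section Forms

variable {E : Type*} [NormedAddCommGroup E] [NormedSpace ℝ E]

/-- A positive definite form on a finite-dimensional space has a bounded unit ball. -/
theorem isVonNBounded_of_posDef [FiniteDimensional ℝ E] (B : E →L[ℝ] E →L[ℝ] ℝ)
    (hB : ∀ v, v ≠ 0 → 0 < B v v) : Bornology.IsVonNBounded ℝ {v : E | B v v < 1} := by
  rcases subsingleton_or_nontrivial E with hE | hE
  · exact (Bornology.isVonNBounded_singleton (𝕜 := ℝ) (0 : E)).subset
      fun v _ ↦ Subsingleton.elim v 0
  -- The minimum `c` of `B v v` on the unit sphere is positive, and by homogeneity `c ‖v‖² ≤ B v v`.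
  obtain ⟨v₀, hv₀, hmin⟩ := (isCompact_sphere (0 : E) 1).exists_isMinOn
    (NormedSpace.sphere_nonempty.2 zero_le_one)
    (by fun_prop : Continuous fun v : E ↦ B v v).continuousOn
  have hc : 0 < B v₀ v₀ := hB v₀ (by rintro rfl; simp at hv₀)
  set c := B v₀ v₀
  have key : ∀ v, c * ‖v‖ ^ 2 ≤ B v v := by
    intro v
    rcases eq_or_ne v 0 with rfl | hv
    · simp
    have hn : ‖v‖ ≠ 0 := norm_ne_zero_iff.2 hv
    have h1 : c ≤ B (‖v‖⁻¹ • v) (‖v‖⁻¹ • v) := hmin (by simp [norm_smul, hn])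
    simp only [map_smul, smul_eq_mul, smul_apply] at h1
    calc c * ‖v‖ ^ 2 ≤ (‖v‖⁻¹ * (‖v‖⁻¹ * B v v)) * ‖v‖ ^ 2 := by gcongr
      _ = B v v := by field_simp
  rw [NormedSpace.isVonNBounded_iff, isBounded_iff_forall_norm_le]
  refine ⟨Real.sqrt c⁻¹, fun v hv ↦ ?_⟩
  apply Real.le_sqrt_of_sq_le
  have h2 : c * ‖v‖ ^ 2 ≤ 1 := (key v).trans (le_of_lt hv)
  rw [← one_div, le_div_iff₀ hc]
  linarith

variable {H : Type*} [TopologicalSpace H] {I : ModelWithCorners ℝ E H}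
  {M : Type*} [TopologicalSpace M] [ChartedSpace H M] [IsManifold I ∞ M]

/-- Typing `v` and `w` in the model space keeps them fixed while the base point is rewritten. -/
theorem RiemMetric.inner_congr (G : RiemMetric I M) {x y : M} (h : x = y) (v w : E) :
    (G.inner x : E →L[ℝ] E →L[ℝ] ℝ) v w = (G.inner y : E →L[ℝ] E →L[ℝ] ℝ) v w := by
  rw [h]

end Forms

/-! ### Local metrics with prescribed restriction to the boundary -/

section LocalForms

variable {n : ℕ} {M : Type*} [TopologicalSpace M] [ChartedSpace (EuclideanHalfSpace (n + 1)) M]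
  [IsManifold (𝓡∂ (n + 1)) ∞ M]

theorem mfderiv_extChartAt_eq_zero {E : Type*} [NormedAddCommGroup E] [NormedSpace ℝ E]
    {H : Type*} [TopologicalSpace H] {I : ModelWithCorners ℝ E H}
    {M : Type*} [TopologicalSpace M] [ChartedSpace H M] [IsManifold I ∞ M] {c y : M}
    (hy : y ∈ (chartAt H c).source) {v : TangentSpace I y}
    (hv : mfderiv I 𝓘(ℝ, E) (extChartAt I c) y v = 0) : v = 0 := by
  have : IsManifold I 1 M := IsManifold.of_le (n := ∞) (by simp)
  have h := isInvertible_mfderiv_extChartAt (I := I) (x := c) (y := y)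
    (by rwa [extChartAt_source])
  exact h.injective (hv.trans (map_zero _).symm)

theorem mfderiv_diffeomorph_eq_zero {E E' : Type*} [NormedAddCommGroup E] [NormedSpace ℝ E]
    [NormedAddCommGroup E'] [NormedSpace ℝ E']
    {H H' : Type*} [TopologicalSpace H] [TopologicalSpace H'] {I : ModelWithCorners ℝ E H}
    {J : ModelWithCorners ℝ E' H'}
    {M N : Type*} [TopologicalSpace M] [ChartedSpace H M] [TopologicalSpace N] [ChartedSpace H' N]
    (d : M ≃ₘ^∞⟮I, J⟯ N) {y : M} {v : TangentSpace I y}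
    (hv : mfderiv I J d y v = 0) : v = 0 := by
  have h1 : mfderiv I I (d.symm ∘ d) y v = mfderiv J I d.symm (d y) (mfderiv I J d y v) := by
    rw [mfderiv_comp y (d.symm.contMDiff.mdifferentiableAt (by simp))
      (d.contMDiff.mdifferentiableAt (by simp))]
    rfl
  have h2 : d.symm ∘ d = id := by ext; simp
  rw [hv, map_zero, h2, mfderiv_id] at h1
  exact h1

/-- Near a boundary point there is a positive definite form restricting to a prescribed metric on
the boundary. -/
theorem exists_local_form_of_mem {V : Set M} [ChartedSpace (EuclideanSpace ℝ (Fin n)) V]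
    [IsManifold (𝓡 n) ∞ V]
    (hV : Manifold.IsSmoothEmbedding (𝓡 n) (𝓡∂ (n + 1)) ∞ (Subtype.val : V → M))
    (hVb : V ⊆ (𝓡∂ (n + 1)).boundary M) {x₀ : M} (hx₀ : x₀ ∈ V)
    (hloc : ∀ᶠ y in 𝓝 x₀, y ∈ (𝓡∂ (n + 1)).boundary M → y ∈ V)
    {W : Type*} [TopologicalSpace W] [ChartedSpace (EuclideanSpace ℝ (Fin n)) W]
    [IsManifold (𝓡 n) ∞ W] (d : V ≃ₘ^∞⟮𝓡 n, 𝓡 n⟯ W) (h : RiemMetric (𝓡 n) W) :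
    ∃ U : Set M, IsOpen U ∧ x₀ ∈ U ∧
      ∃ B : ∀ x : M, TangentSpace (𝓡∂ (n + 1)) x →L[ℝ] TangentSpace (𝓡∂ (n + 1)) x →L[ℝ] ℝ,
        (∀ x ∈ U, ContMDiffAt (𝓡∂ (n + 1)) ((𝓡∂ (n + 1)).prod 𝓘(ℝ, EuclideanSpace ℝ (Fin (n + 1))
            →L[ℝ] EuclideanSpace ℝ (Fin (n + 1)) →L[ℝ] ℝ)) ∞
          (fun x ↦ TotalSpace.mk' (EuclideanSpace ℝ (Fin (n + 1)) →L[ℝ]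
            EuclideanSpace ℝ (Fin (n + 1)) →L[ℝ] ℝ) (E := fun x : M ↦
              TangentSpace (𝓡∂ (n + 1)) x →L[ℝ] TangentSpace (𝓡∂ (n + 1)) x →L[ℝ] ℝ) x (B x)) x) ∧
        ∀ x ∈ U, (∀ v w, B x v w = B x w v) ∧ (∀ v, v ≠ 0 → 0 < B x v v) ∧
          ∀ (hx : x ∈ V) (v w : TangentSpace (𝓡 n) (⟨x, hx⟩ : V)),
            B x (mfderiv (𝓡 n) (𝓡∂ (n + 1)) (Subtype.val : V → M) ⟨x, hx⟩ v)
              (mfderiv (𝓡 n) (𝓡∂ (n + 1)) (Subtype.val : V → M) ⟨x, hx⟩ w) =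
            h.inner (d ⟨x, hx⟩) (mfderiv (𝓡 n) (𝓡 n) d ⟨x, hx⟩ v)
              (mfderiv (𝓡 n) (𝓡 n) d ⟨x, hx⟩ w) := by
  obtain ⟨r, U, hUo, hxU, hUs, hr, hrV, hrφ⟩ := exists_smooth_retraction hV hVb hx₀ hloc
  set φ := extChartAt (𝓡∂ (n + 1)) x₀ with hφ
  have hφU : ∀ y ∈ U, ContMDiffAt (𝓡∂ (n + 1)) 𝓘(ℝ, EuclideanSpace ℝ (Fin (n + 1))) ∞ φ y :=
    fun y hy ↦ contMDiffAt_extChartAt' (hUs hy)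
  have hrU : ∀ y ∈ U, ContMDiffAt (𝓡∂ (n + 1)) (𝓡 n) ∞ r y :=
    fun y hy ↦ hr.contMDiffAt (hUo.mem_nhds hy)
  have hkU : ∀ y ∈ U, ContMDiffAt (𝓡∂ (n + 1)) (𝓡 n) ∞ (d ∘ r) y :=
    fun y hy ↦ d.contMDiff.contMDiffAt.comp y (hrU y hy)
  let pr : EuclideanSpace ℝ (Fin (n + 1)) →L[ℝ] ℝ := EuclideanSpace.proj (0 : Fin (n + 1))
  have hξU : ∀ y ∈ U, ContMDiffAt (𝓡∂ (n + 1)) 𝓘(ℝ, ℝ) ∞ (pr ∘ φ) y :=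
    fun y hy ↦ pr.contDiff.contMDiff.contMDiffAt.comp y (hφU y hy)
  let L (x : M) : EuclideanSpace ℝ (Fin (n + 1)) →L[ℝ] EuclideanSpace ℝ (Fin n) :=
    mfderiv (𝓡∂ (n + 1)) (𝓡 n) (d ∘ r) x
  let η (x : M) : EuclideanSpace ℝ (Fin (n + 1)) →L[ℝ] ℝ :=
    mvfderiv (𝓡∂ (n + 1)) (pr ∘ φ) x
  -- The form `(d ∘ r)^* h + dξ ⊗ dξ`: the first summand sees the directions along the boundary, the
  -- second the normal one.
  let B (x : M) : EuclideanSpace ℝ (Fin (n + 1)) →L[ℝ] EuclideanSpace ℝ (Fin (n + 1)) →L[ℝ] ℝ :=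
    ContinuousLinearMap.bilinearComp (h.inner ((d ∘ r) x) :
      EuclideanSpace ℝ (Fin n) →L[ℝ] EuclideanSpace ℝ (Fin n) →L[ℝ] ℝ) (L x) (L x) +
    (η x).smulRight (η x)
  have hB : ∀ x (v w : EuclideanSpace ℝ (Fin (n + 1))), B x v w =
      (h.inner ((d ∘ r) x) : EuclideanSpace ℝ (Fin n) →L[ℝ] EuclideanSpace ℝ (Fin n) →L[ℝ] ℝ)
        (L x v) (L x w) + η x v * η x w := fun x v w ↦ rfl
  refine ⟨U, hUo, hxU, B, fun x hx ↦ ?_, fun x hx ↦ ⟨fun v w ↦ ?_, fun v hv ↦ ?_, ?_⟩⟩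
  · refine contMDiffAt_bilin_of_apply fun v w hv hw ↦ ?_
    have h1 := contMDiffAt_metric_apply (f := d ∘ r) (h := h.inner) h.contMDiff.contMDiffAt
      (hkU x hx) (contMDiffAt_mfderiv_apply (hkU x hx) hv)
      (contMDiffAt_mfderiv_apply (hkU x hx) hw)
    have h2 := (contMDiffAt_mvfderiv_apply (hξU x hx) hv).mul
      (contMDiffAt_mvfderiv_apply (hξU x hx) hw)
    exact (h1.add h2).congr_of_eventuallyEq (Eventually.of_forall fun y ↦ hB y _ _)
  · refine (hB x v w).trans (Eq.trans ?_ (hB x w v).symm)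
    rw [mul_comm]
    congr 1
    exact h.symm _ _ _
  · refine lt_of_lt_of_eq ?_ (hB x v v).symm
    -- Both summands are nonnegative, so both vanish: `dξ(v) = 0` and `dr(v) = 0`. In the chart `r`
    -- is the wall projection, so the wall component of `dφ(v)` vanishes along with the normal one,
    -- forcing `v = 0`.
    by_contra hcon
    have hη : η x v = 0 := by
      have h1 : 0 ≤ (h.inner ((d ∘ r) x) : EuclideanSpace ℝ (Fin n) →L[ℝ]
          EuclideanSpace ℝ (Fin n) →L[ℝ] ℝ) (L x v) (L x v) := by
        rcases eq_or_ne (L x v) 0 with h0 | h0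
        · rw [h0]
          exact (map_zero ((h.inner ((d ∘ r) x) : EuclideanSpace ℝ (Fin n) →L[ℝ]
            EuclideanSpace ℝ (Fin n) →L[ℝ] ℝ) 0)).ge
        · exact (h.pos _ _ h0).le
      nlinarith [mul_self_nonneg (η x v)]
    have hL : L x v = 0 := by
      by_contra h0
      have h1 : 0 < (h.inner ((d ∘ r) x) : EuclideanSpace ℝ (Fin n) →L[ℝ]
          EuclideanSpace ℝ (Fin n) →L[ℝ] ℝ) (L x v) (L x v) := h.pos _ _ h0
      rw [hη] at hcon
      linarith
    have hdr : mfderiv (𝓡∂ (n + 1)) (𝓡 n) r x v = 0 := by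
      refine mfderiv_diffeomorph_eq_zero d (Eq.trans ?_ hL)
      simp only [L]
      rw [mfderiv_comp x (d.contMDiff.mdifferentiableAt (by simp))
        ((hrU x hx).mdifferentiableAt (by simp))]
      rfl
    have hιr : MDifferentiableAt (𝓡∂ (n + 1)) (𝓡∂ (n + 1)) (Subtype.val ∘ r) x :=
      (hV.contMDiff.contMDiffAt.comp x (hrU x hx)).mdifferentiableAt (by simp)
    have hφr : MDifferentiableAt (𝓡∂ (n + 1)) 𝓘(ℝ, EuclideanSpace ℝ (Fin (n + 1))) φ
        ((Subtype.val ∘ r) x) :=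
      (contMDiffAt_extChartAt' (n := ∞) (hrφ x hx).1).mdifferentiableAt (by simp)
    have h1 : mfderiv (𝓡∂ (n + 1)) 𝓘(ℝ, EuclideanSpace ℝ (Fin (n + 1)))
        (φ ∘ (Subtype.val ∘ r)) x v = 0 := by
      rw [mfderiv_comp x hφr hιr, mfderiv_comp x (hV.contMDiff.mdifferentiableAt (by simp))
        ((hrU x hx).mdifferentiableAt (by simp))]
      change mfderiv (𝓡∂ (n + 1)) 𝓘(ℝ, EuclideanSpace ℝ (Fin (n + 1))) φ _ (mfderiv (𝓡 n)
        (𝓡∂ (n + 1)) (Subtype.val : V → M) _ (mfderiv (𝓡∂ (n + 1)) (𝓡 n) r x v)) = 0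
      rw [hdr, map_zero, map_zero]
    have hev : (φ ∘ (Subtype.val ∘ r)) =ᶠ[𝓝 x] (wallProj n ∘ φ) :=
      Filter.eventuallyEq_of_mem (hUo.mem_nhds hx) fun y hy ↦ (hrφ y hy).2
    have hφx := (hφU x hx).mdifferentiableAt (by simp)
    rw [hev.mfderiv_eq, mfderiv_comp x ((wallProj n).contDiff.contMDiff.mdifferentiableAt
      (n := ∞) (by simp)) hφx, ContinuousLinearMap.mfderiv_eq] at h1
    have h2 : η x v = pr (mfderiv (𝓡∂ (n + 1)) 𝓘(ℝ, EuclideanSpace ℝ (Fin (n + 1))) φ x v) := by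
      change mfderiv (𝓡∂ (n + 1)) 𝓘(ℝ, ℝ) (pr ∘ φ) x v = _
      rw [mfderiv_comp x (pr.contDiff.contMDiff.mdifferentiableAt
        (n := ∞) (by simp)) hφx, ContinuousLinearMap.mfderiv_eq]
      rfl
    rw [hη] at h2
    exact hv (mfderiv_extChartAt_eq_zero (hUs hx) ((wallProj_eq_self h2.symm).symm.trans h1))
  · intro hxV v w
    have hval : ContinuousAt (Subtype.val : V → M) ⟨x, hxV⟩ := continuousAt_subtype_val
    have hxmem : ∀ᶠ q : V in 𝓝 (⟨x, hxV⟩ : V), (q : M) ∈ U :=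
      hval.eventually (hUo.mem_nhds hx)
    have hvald := hV.contMDiff.mdifferentiableAt (x := ⟨x, hxV⟩) (by simp)
    -- On `V` the retraction is the identity, so `d = (d ∘ r) ∘ val` there; and `ξ` vanishes on `V`,
    -- so `dξ` contributes nothing to the restriction.
    have hd : mfderiv (𝓡 n) (𝓡 n) d ⟨x, hxV⟩ =
        (mfderiv (𝓡∂ (n + 1)) (𝓡 n) (d ∘ r) x).comp
          (mfderiv (𝓡 n) (𝓡∂ (n + 1)) (Subtype.val : V → M) ⟨x, hxV⟩) := by
      have hev : (d : V → W) =ᶠ[𝓝 ⟨x, hxV⟩] (d ∘ r) ∘ Subtype.val := by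
        filter_upwards [hxmem] with q hq
        simp [hrV q hq q.2]
      rw [hev.mfderiv_eq]
      exact mfderiv_comp _ ((hkU x hx).mdifferentiableAt (by simp)) hvald
    have hη : ∀ v, η x (mfderiv (𝓡 n) (𝓡∂ (n + 1)) (Subtype.val : V → M) ⟨x, hxV⟩ v) = 0 := by
      intro v
      have hev : ((pr ∘ φ) ∘ Subtype.val : V → ℝ) =ᶠ[𝓝 ⟨x, hxV⟩] fun _ ↦ 0 := by
        filter_upwards [hxmem] with q hq
        exact (mem_boundary_iff (hUs hq)).1 (hVb q.2)
      have h1 := mvfderiv_comp_apply (⟨x, hxV⟩ : V) (f := (Subtype.val : V → M))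
        (g := pr ∘ φ) ((hξU x hx).mdifferentiableAt (by simp)) hvald v
      refine h1.symm.trans ?_
      change mfderiv (𝓡 n) 𝓘(ℝ, ℝ) ((pr ∘ φ) ∘ Subtype.val : V → ℝ) ⟨x, hxV⟩ v = _
      rw [hev.mfderiv_eq, mfderiv_const]
      rfl
    refine (hB x _ _).trans ?_
    rw [hη v, hη w, mul_zero, add_zero, hd]
    exact h.inner_congr (by simp [hrV x hx hxV]) _ _

end LocalForms

/-! ### Normalizing the differential, and the Lorentzian signature -/

section VectorField

variable {E : Type*} [NormedAddCommGroup E] [NormedSpace ℝ E] [FiniteDimensional ℝ E]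
  {H : Type*} [TopologicalSpace H] {I : ModelWithCorners ℝ E H}
  {M : Type*} [TopologicalSpace M] [ChartedSpace H M] [IsManifold I ∞ M]

/-- A function without critical points on a closed set has a vector field along which its
derivative is `1` on that set. -/
theorem exists_vectorField_mvfderiv_eq_one [T2Space M] [SigmaCompactSpace M] {f : M → ℝ}
    (hf : ContMDiff I 𝓘(ℝ, ℝ) ∞ f) {S : Set M} (hS : IsClosed S)
    (hfS : ∀ x ∈ S, ¬ IsCritPt I f x) :
    ∃ ν : ∀ x : M, TangentSpace I x,
      ContMDiff I (I.prod 𝓘(ℝ, E)) ∞ (fun x ↦ TotalSpace.mk' E x (ν x)) ∧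
      ∀ x ∈ S, mvfderiv I f x (ν x) = 1 := by
  obtain ⟨ν, hν⟩ := exists_contMDiffSection_forall_mem_convex_of_local (n := (⊤ : ℕ∞)) I
    (F_fiber := E) (TangentSpace I : M → Type _) (fun x ↦ {v | x ∈ S → mvfderiv I f x v = 1})
    (fun x v hv w hw a b _ _ hab hx ↦ by
      rw [map_add, map_smul, map_smul, hv hx, hw hx]; simpa using hab) (fun x₀ ↦ by
    by_cases hx₀ : x₀ ∈ S
    · obtain ⟨e, he⟩ : ∃ e : TangentSpace I x₀, mvfderiv I f x₀ e ≠ 0 := by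
        by_contra! hcon
        exact hfS x₀ hx₀ (ContinuousLinearMap.ext hcon)
      set T := trivializationAt E (TangentSpace I : M → Type _) x₀ with hT
      have hx₀T : x₀ ∈ T.baseSet := FiberBundle.mem_baseSet_trivializationAt' x₀
      -- Extend `e` to a constant field `s` of the trivialization and divide by `df(s)`, which is
      -- nonzero near `x₀`.
      let e' : E := T.continuousLinearMapAt ℝ x₀ e
      let s (x : M) : TangentSpace I x := T.symmL ℝ x e'
      have hs : ∀ x ∈ T.baseSet, ContMDiffAt I (I.prod 𝓘(ℝ, E)) ∞
          (fun x ↦ TotalSpace.mk' E x (s x)) x :=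
        fun x hx ↦ contMDiffAt_symmL_trivializationAt x₀ e' hx
      have hfs : ∀ x ∈ T.baseSet, ContMDiffAt I 𝓘(ℝ, ℝ) ∞ (fun x ↦ mvfderiv I f x (s x)) x :=
        fun x hx ↦ contMDiffAt_mvfderiv_apply hf.contMDiffAt (hs x hx)
      have hne : ∀ᶠ x in 𝓝 x₀, mvfderiv I f x (s x) ≠ 0 := by
        refine (hfs x₀ hx₀T).continuousAt.eventually_ne ?_
        have hs₀ : s x₀ = e := T.symmL_continuousLinearMapAt hx₀T e
        rwa [hs₀]
      refine ⟨T.baseSet ∩ {x | mvfderiv I f x (s x) ≠ 0},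
        Filter.inter_mem (T.open_baseSet.mem_nhds hx₀T) hne,
        fun x ↦ (mvfderiv I f x (s x))⁻¹ • s x, fun x hx ↦ ?_, fun x hx _ ↦ ?_⟩
      · exact (((hfs x hx.1).inv₀ hx.2).smul_section (hs x hx.1)).contMDiffWithinAt
      · rw [map_smul, smul_eq_mul, inv_mul_cancel₀ hx.2]
    · exact ⟨Sᶜ, hS.isOpen_compl.mem_nhds hx₀, fun _ ↦ 0,
        (contMDiff_zeroSection ℝ (TangentSpace I : M → Type _)).contMDiffOn,
        fun x hx h ↦ absurd h hx⟩)
  exact ⟨ν, ν.contMDiff, hν⟩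

/-- A Riemannian metric from a smooth field of positive definite forms. -/
noncomputable def RiemMetric.ofPosDef (B : M → E →L[ℝ] E →L[ℝ] ℝ)
    (symm : ∀ x v w, B x v w = B x w v) (pos : ∀ x v, v ≠ 0 → 0 < B x v v)
    (smooth : ContMDiff I (I.prod 𝓘(ℝ, E →L[ℝ] E →L[ℝ] ℝ)) ∞
      (fun x ↦ TotalSpace.mk' (E →L[ℝ] E →L[ℝ] ℝ)
        (E := fun x : M ↦ TangentSpace I x →L[ℝ] TangentSpace I x →L[ℝ] ℝ) x (B x))) :
    RiemMetric I M where
  inner := B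
  symm := symm
  pos := pos
  isVonNBounded x := isVonNBounded_of_posDef (B x) (pos x)
  contMDiff := smooth

/-- A metric may be changed so that `df` has norm `1` where `df(ν) = 1`, without changing its
restriction to the kernel of `df`. -/
theorem exists_metric_unit_differential {f : M → ℝ} (hf : ContMDiff I 𝓘(ℝ, ℝ) ∞ f)
    {ν : ∀ x : M, TangentSpace I x}
    (hν : ContMDiff I (I.prod 𝓘(ℝ, E)) ∞ (fun x ↦ TotalSpace.mk' E x (ν x)))
    (G : RiemMetric I M) :
    ∃ G' : RiemMetric I M,
      (∀ x, mvfderiv I f x (ν x) = 1 → dfSq G' f x = 1) ∧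
      ∀ x v w, mvfderiv I f x v = 0 → mvfderiv I f x w = 0 →
        G'.inner x v w = G.inner x v w := by
  let η (x : M) : E →L[ℝ] ℝ := mvfderiv I f x
  let N (x : M) : E := ν x
  let g (x : M) : E →L[ℝ] E →L[ℝ] ℝ := G.inner x
  -- Where `df(ν) = 1` this is the projection onto `ker df` along `ν`. Elsewhere it need not be a
  -- projection, but `B` remains positive definite: `P v = v` if `df(v) = 0`, and otherwise the term
  -- `df(v)²` is positive.
  let P (x : M) : E →L[ℝ] E := ContinuousLinearMap.id ℝ E - (η x).smulRight (N x)
  let B (x : M) : E →L[ℝ] E →L[ℝ] ℝ :=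
    ContinuousLinearMap.bilinearComp (g x) (P x) (P x) +
      (η x).smulRight (η x)
  have hB : ∀ x (v w : E), B x v w = g x
      (v - η x v • N x) (w - η x w • N x) + η x v * η x w := fun _ _ _ ↦ rfl
  have hG0 : ∀ x (v : E), 0 ≤ g x v v := by
    intro x v
    rcases eq_or_ne v 0 with h | h
    · rw [h]
      exact (map_zero (g x 0)).ge
    · exact (G.pos x v h).le
  have hBN : ∀ x, η x (N x) = 1 → ∀ w, B x (N x) w = η x w := fun x hx w ↦ by
    rw [hB, hx, one_smul, sub_self, map_zero, one_mul]
    exact zero_add _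
  have hBk : ∀ x (v w : E), η x v = 0 → η x w = 0 → B x v w = g x v w := fun x v w hv hw ↦ by
    rw [hB, hv, hw, zero_smul, sub_zero, sub_zero, mul_zero, add_zero]
  have symm : ∀ x v w, B x v w = B x w v := fun x v w ↦ by
    rw [hB, hB, mul_comm]
    congr 1
    exact G.symm _ _ _
  have pos : ∀ x v, v ≠ 0 → 0 < B x v v := fun x v hv ↦ by
    rw [hB]
    by_cases h : η x v = 0
    · rw [h, zero_smul, sub_zero, mul_zero, add_zero]
      exact G.pos x v hv
    · have := hG0 x (v - η x v • N x)
      have := mul_self_pos.2 h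
      linarith
  have smooth : ContMDiff I (I.prod 𝓘(ℝ, E →L[ℝ] E →L[ℝ] ℝ)) ∞
      (fun x ↦ TotalSpace.mk' (E →L[ℝ] E →L[ℝ] ℝ)
        (E := fun x : M ↦ TangentSpace I x →L[ℝ] TangentSpace I x →L[ℝ] ℝ) x (B x)) := by
    intro x
    refine contMDiffAt_bilin_of_apply fun v w hv hw ↦ ?_
    have hηv := contMDiffAt_mvfderiv_apply hf.contMDiffAt hv
    have hηw := contMDiffAt_mvfderiv_apply hf.contMDiffAt hw
    exact (contMDiffAt_metric_apply (f := id) G.contMDiff.contMDiffAt contMDiffAt_id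
      (hv.sub_section (hηv.smul_section hν.contMDiffAt))
      (hw.sub_section (hηw.smul_section hν.contMDiffAt))).add (hηv.mul hηw)
  refine ⟨.ofPosDef B symm pos smooth, fun x hx ↦ ?_, fun x v w hv hw ↦ ?_⟩
  · have hgrad : grad (RiemMetric.ofPosDef B symm pos smooth) f x = ν x := by
      rw [grad, LinearEquiv.symm_apply_eq]
      ext w
      rw [LinearMap.BilinForm.toDual_def]
      exact (hBN x hx w).symm
    rw [dfSq, hgrad, hx]
  · exact hBk x v w hv hw

/-- Where `df ≠ 0`, the Morse metric is Lorentzian and the gradient of `f` is timelike. -/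
theorem morseMetric_isLorentzian (f : M → ℝ) (G : RiemMetric I M) {ζ : ℝ} (hζ : 1 < ζ) {x : M}
    (hx : ¬ IsCritPt I f x) :
    IsLorentzian (morseMetric f G ζ x) ∧
      morseMetric f G ζ x (grad G f x) (grad G f x) < 0 := by
  set X := grad G f x with hX
  have hGX : ∀ w, G.toTensor x X w = mvfderiv I f x w := toTensor_grad G f x
  have hX0 : X ≠ 0 := by
    intro h
    refine hx (ContinuousLinearMap.ext fun w ↦ ?_)
    rw [← hGX, h, map_zero]
    rfl
  have hm : ∀ v w, morseMetric f G ζ x v w =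
      mvfderiv I f x X * G.toTensor x v w - ζ * (mvfderiv I f x v * mvfderiv I f x w) := by
    intro v w
    simp [morseMetric, dfSq, hX]
  have hc : 0 < mvfderiv I f x X := by
    rw [← hGX]
    exact G.pos x X hX0
  set c := mvfderiv I f x X
  have hneg : morseMetric f G ζ x X X < 0 := by
    rw [hm, hGX]
    nlinarith [mul_pos hc hc]
  refine ⟨⟨⟨fun v w ↦ ?_⟩, X, hneg, fun w hw hw0 ↦ ?_⟩, hneg⟩
  · have : G.toTensor x v w = G.toTensor x w v := G.symm x v w
    refine (hm v w).trans (Eq.trans ?_ (hm w v).symm)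
    rw [this, mul_comm (mvfderiv I f x v)]
  -- Orthogonality to `X` reads `c (1 - ζ) df(w) = 0`, so `w` lies in `ker df`, where the form is `c
  -- G`.
  · rw [hm, hGX] at hw
    have hw' : mvfderiv I f x w = 0 := by
      have h1 : (c * (1 - ζ)) * mvfderiv I f x w = 0 := by linarith
      rcases mul_eq_zero.1 h1 with h2 | h2
      · rcases mul_eq_zero.1 h2 with h3 | h3 <;> linarith
      · exact h2
    rw [hm, hw', mul_zero, mul_zero, sub_zero]
    exact mul_pos hc (G.pos x w hw0)

end VectorField

/-! ### Gluing the metric and restricting the Morse metric -/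

section GlobalMetric

variable {n : ℕ} {M : Type*} [TopologicalSpace M] [ChartedSpace (EuclideanHalfSpace (n + 1)) M]

/-- Every point has a neighbourhood with a smooth positive definite form. -/
theorem exists_local_form {F : Type*} [NormedAddCommGroup F] [InnerProductSpace ℝ F]
    [FiniteDimensional ℝ F] {H : Type*} [TopologicalSpace H] {I : ModelWithCorners ℝ F H}
    {M : Type*} [TopologicalSpace M] [ChartedSpace H M] [IsManifold I ∞ M] (x₀ : M) :
    ∃ B : ∀ x : M, TangentSpace I x →L[ℝ] TangentSpace I x →L[ℝ] ℝ,
      ∀ x ∈ (chartAt H x₀).source, ContMDiffAt I (I.prod 𝓘(ℝ, F →L[ℝ] F →L[ℝ] ℝ)) ∞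
          (fun x ↦ TotalSpace.mk' (F →L[ℝ] F →L[ℝ] ℝ) (E := fun x : M ↦
              TangentSpace I x →L[ℝ] TangentSpace I x →L[ℝ] ℝ) x (B x)) x ∧
        (∀ v w, B x v w = B x w v) ∧ (∀ v, v ≠ 0 → 0 < B x v v) := by
  let L (x : M) : F →L[ℝ] F := mvfderiv I (extChartAt I x₀) x
  let B (x : M) : F →L[ℝ] F →L[ℝ] ℝ :=
    ContinuousLinearMap.bilinearComp (innerSL ℝ : F →L[ℝ] F →L[ℝ] ℝ) (L x) (L x)
  refine ⟨B, fun x hx ↦ ⟨contMDiffAt_bilin_of_apply fun v w hv hw ↦ ?_, fun v w ↦ ?_,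
    fun v hv ↦ ?_⟩⟩
  · have h := contMDiffAt_extChartAt' (I := I) (n := ∞) hx
    have h1 := contMDiffAt_mvfderiv_apply h hv
    have h2 := contMDiffAt_mvfderiv_apply h hw
    exact (contDiff_inner (𝕜 := ℝ)).contMDiff.contMDiffAt.comp x (h1.prodMk_space h2)
  · exact real_inner_comm _ _
  · refine real_inner_self_pos.2 fun h0 ↦ hv ?_
    exact mfderiv_extChartAt_eq_zero hx h0

/-- `V₁` is closed and misses `x₀`, so it misses a neighbourhood. There the condition on `V₁` is
vacuous and the boundary is all in `V₀`; exchanging the roles of the two sets treats the points of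
`V₁`. -/
theorem eventually_boundary_imp_left {V₀ V₁ : Set M}
    (hb : (𝓡∂ (n + 1)).boundary M = V₀ ∪ V₁) (h₁ : IsClosed V₁) (hd : Disjoint V₀ V₁) {x₀ : M}
    (hx₀ : x₀ ∈ V₀) : ∀ᶠ y in 𝓝 x₀, y ∉ V₁ ∧ (y ∈ (𝓡∂ (n + 1)).boundary M → y ∈ V₀) := by
  filter_upwards [h₁.isOpen_compl.mem_nhds (Set.disjoint_left.1 hd hx₀)] with y hy
  refine ⟨hy, fun h ↦ ?_⟩
  rw [hb] at h
  exact h.resolve_right hy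

/-- The form `B` on `T_x M` restricts to the form `d^* h` on the tangent space of `V`. -/
def RestrictsTo {V : Set M} [ChartedSpace (EuclideanSpace ℝ (Fin n)) V]
    {W : Type*} [TopologicalSpace W] [ChartedSpace (EuclideanSpace ℝ (Fin n)) W]
    [IsManifold (𝓡 n) ∞ W] (d : V ≃ₘ^∞⟮𝓡 n, 𝓡 n⟯ W) (h : RiemMetric (𝓡 n) W) (x : M)
    (B : TangentSpace (𝓡∂ (n + 1)) x →L[ℝ] TangentSpace (𝓡∂ (n + 1)) x →L[ℝ] ℝ) : Prop :=
  ∀ (hx : x ∈ V) (v w : TangentSpace (𝓡 n) (⟨x, hx⟩ : V)),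
    B (mfderiv (𝓡 n) (𝓡∂ (n + 1)) (Subtype.val : V → M) ⟨x, hx⟩ v)
      (mfderiv (𝓡 n) (𝓡∂ (n + 1)) (Subtype.val : V → M) ⟨x, hx⟩ w) =
    h.inner (d ⟨x, hx⟩) (mfderiv (𝓡 n) (𝓡 n) d ⟨x, hx⟩ v) (mfderiv (𝓡 n) (𝓡 n) d ⟨x, hx⟩ w)

/-- The condition is affine in `B`, which is what gluing by a partition of unity needs. -/
theorem convex_restrictsTo {V : Set M} [ChartedSpace (EuclideanSpace ℝ (Fin n)) V]
    {W : Type*} [TopologicalSpace W] [ChartedSpace (EuclideanSpace ℝ (Fin n)) W]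
    [IsManifold (𝓡 n) ∞ W] (d : V ≃ₘ^∞⟮𝓡 n, 𝓡 n⟯ W) (h : RiemMetric (𝓡 n) W) (x : M) :
    Convex ℝ {B | RestrictsTo d h x B} := by
  intro B hB C hC a b _ _ hab hx v w
  have h1 := hB hx v w
  have h2 := hC hx v w
  change a * B _ _ + b * C _ _ = _
  rw [h1, h2, ← add_mul, hab, one_mul]

variable [IsManifold (𝓡∂ (n + 1)) ∞ M] {V₀ V₁ : Set M}
  [ChartedSpace (EuclideanSpace ℝ (Fin n)) V₀] [IsManifold (𝓡 n) ∞ V₀]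
  [ChartedSpace (EuclideanSpace ℝ (Fin n)) V₁] [IsManifold (𝓡 n) ∞ V₁]
  {W₀ : Type*} [TopologicalSpace W₀]
  [ChartedSpace (EuclideanSpace ℝ (Fin n)) W₀] [IsManifold (𝓡 n) ∞ W₀]
  {W₁ : Type*} [TopologicalSpace W₁]
  [ChartedSpace (EuclideanSpace ℝ (Fin n)) W₁] [IsManifold (𝓡 n) ∞ W₁]

set_option synthInstance.maxHeartbeats 200000 in
/-- A manifold with boundary carries a Riemannian metric with prescribed restrictions to the
components of the boundary. -/
theorem exists_metric_restrictsTo [T2Space M] [SigmaCompactSpace M] (hM : IsTriad n V₀ V₁)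
    (d₀ : V₀ ≃ₘ^∞⟮𝓡 n, 𝓡 n⟯ W₀) (d₁ : V₁ ≃ₘ^∞⟮𝓡 n, 𝓡 n⟯ W₁)
    (h₀ : RiemMetric (𝓡 n) W₀) (h₁ : RiemMetric (𝓡 n) W₁) :
    ∃ G : RiemMetric (𝓡∂ (n + 1)) M,
      ∀ x, RestrictsTo d₀ h₀ x (G.inner x) ∧ RestrictsTo d₁ h₁ x (G.inner x) := by
  obtain ⟨B, hB⟩ := exists_contMDiffSection_forall_mem_convex_of_local (n := (⊤ : ℕ∞))
    (𝓡∂ (n + 1)) (F_fiber := EuclideanSpace ℝ (Fin (n + 1)) →L[ℝ]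
      EuclideanSpace ℝ (Fin (n + 1)) →L[ℝ] ℝ)
    (fun x : M ↦ TangentSpace (𝓡∂ (n + 1)) x →L[ℝ] TangentSpace (𝓡∂ (n + 1)) x →L[ℝ] ℝ)
    (fun x ↦ {B | (∀ v w, B v w = B w v) ∧ (∀ v, v ≠ 0 → 0 < B v v)} ∩
      ({B | RestrictsTo d₀ h₀ x B} ∩ {B | RestrictsTo d₁ h₁ x B}))
    (fun x ↦ by
      refine Convex.inter ?_ ((convex_restrictsTo _ _ _).inter (convex_restrictsTo _ _ _))
      intro B hB C hC a b ha hb hab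
      refine ⟨fun v w ↦ ?_, fun v hv ↦ ?_⟩
      · change a * B _ _ + b * C _ _ = a * B _ _ + b * C _ _
        rw [hB.1, hC.1]
      · change 0 < a * B _ _ + b * C _ _
        have h1 := hB.2 v hv
        have h2 := hC.2 v hv
        rcases ha.eq_or_lt with rfl | ha
        · rw [zero_add] at hab
          rw [hab]
          linarith
        · have := mul_pos ha h1
          have := mul_nonneg hb h2.le
          linarith)
    (fun x₀ ↦ by
      by_cases hx₀ : x₀ ∈ V₀
      · have hev := eventually_boundary_imp_left hM.boundary_eq hM.isClosed₁ hM.disjoint hx₀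
        obtain ⟨U, hU, hxU, B, hBs, hB⟩ := exists_local_form_of_mem hM.embedding₀
          (hM.boundary_eq ▸ subset_union_left) hx₀ (hev.mono fun _ h ↦ h.2) d₀ h₀
        refine ⟨U ∩ V₁ᶜ, Filter.inter_mem (hU.mem_nhds hxU) (hev.mono fun _ h ↦ h.1), B,
          fun x hx ↦ (hBs x hx.1).contMDiffWithinAt, fun x hx ↦ ?_⟩
        obtain ⟨h1, h2, h3⟩ := hB x hx.1
        exact ⟨⟨h1, h2⟩, h3, fun h ↦ absurd h hx.2⟩
      by_cases hx₁ : x₀ ∈ V₁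
      · have hev := eventually_boundary_imp_left (hM.boundary_eq.trans (union_comm _ _))
          hM.isClosed₀ hM.disjoint.symm hx₁
        obtain ⟨U, hU, hxU, B, hBs, hB⟩ := exists_local_form_of_mem hM.embedding₁
          (hM.boundary_eq ▸ subset_union_right) hx₁ (hev.mono fun _ h ↦ h.2) d₁ h₁
        refine ⟨U ∩ V₀ᶜ, Filter.inter_mem (hU.mem_nhds hxU) (hev.mono fun _ h ↦ h.1), B,
          fun x hx ↦ (hBs x hx.1).contMDiffWithinAt, fun x hx ↦ ?_⟩
        obtain ⟨h1, h2, h3⟩ := hB x hx.1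
        exact ⟨⟨h1, h2⟩, fun h ↦ absurd h hx.2, h3⟩
      · obtain ⟨B, hB⟩ := exists_local_form (I := 𝓡∂ (n + 1)) x₀
        refine ⟨(chartAt (EuclideanHalfSpace (n + 1)) x₀).source ∩ (V₀ᶜ ∩ V₁ᶜ),
          Filter.inter_mem ((chartAt _ x₀).open_source.mem_nhds (mem_chart_source _ x₀))
            (Filter.inter_mem (hM.isClosed₀.isOpen_compl.mem_nhds hx₀)
              (hM.isClosed₁.isOpen_compl.mem_nhds hx₁)), B,
          fun x hx ↦ (hB x hx.1).1.contMDiffWithinAt, fun x hx ↦ ⟨(hB x hx.1).2, ?_, ?_⟩⟩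
        · exact fun h ↦ absurd h hx.2.1
        · exact fun h ↦ absurd h hx.2.2)
  exact ⟨.ofPosDef (fun x ↦ B x) (fun x ↦ (hB x).1.1) (fun x ↦ (hB x).1.2) B.contMDiff,
    fun x ↦ (hB x).2⟩

/-- The restriction of the Morse metric to a level set of `f` on which `|df| = 1`. -/
theorem pullback_morseMetric {V : Set M} [ChartedSpace (EuclideanSpace ℝ (Fin n)) V]
    (hV : ContMDiff (𝓡 n) (𝓡∂ (n + 1)) ∞ (Subtype.val : V → M))
    {W : Type*} [TopologicalSpace W] [ChartedSpace (EuclideanSpace ℝ (Fin n)) W]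
    [IsManifold (𝓡 n) ∞ W] (d : V ≃ₘ^∞⟮𝓡 n, 𝓡 n⟯ W) (h : RiemMetric (𝓡 n) W)
    {f : M → ℝ} (hf : ContMDiff (𝓡∂ (n + 1)) 𝓘(ℝ, ℝ) ∞ f) {c : ℝ} (hfV : ∀ x ∈ V, f x = c)
    {G G' : RiemMetric (𝓡∂ (n + 1)) M} (hG : ∀ x, RestrictsTo d h x (G.inner x))
    (hG' : ∀ x v w, mvfderiv (𝓡∂ (n + 1)) f x v = 0 → mvfderiv (𝓡∂ (n + 1)) f x w = 0 →
        G'.inner x v w = G.inner x v w)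
    (hdf : ∀ x ∈ V, dfSq G' f x = 1) (ζ : ℝ) :
    pullback (𝓡 n) (𝓡 n) d.symm
      (pullback (𝓡∂ (n + 1)) (𝓡 n) (Subtype.val : V → M) (morseMetric f G' ζ)) = h.toTensor := by
  funext y
  ext v w
  set q := d.symm y with hq
  have hker : ∀ u, mvfderiv (𝓡∂ (n + 1)) f q
      (mfderiv (𝓡 n) (𝓡∂ (n + 1)) (Subtype.val : V → M) q u) = 0 := by
    intro u
    have h1 := mvfderiv_comp_apply q (f := (Subtype.val : V → M)) (g := f)
      (hf.mdifferentiableAt (by simp)) (hV.mdifferentiableAt (by simp)) u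
    have h2 : f ∘ (Subtype.val : V → M) = fun _ ↦ c := funext fun p ↦ hfV p p.2
    rw [← h1, h2, mvfderiv_const]
    rfl
  -- On `ker df` the `ζ` term drops out, and `|df|² = 1` on `V`.
  have hm : ∀ u u', mvfderiv (𝓡∂ (n + 1)) f q u = 0 → mvfderiv (𝓡∂ (n + 1)) f q u' = 0 →
      morseMetric f G' ζ (q : M) u u' = G'.inner q u u' := by
    intro u u' hu hu'
    have : morseMetric f G' ζ (q : M) u u' = dfSq G' f q * G'.inner q u u' -
      ζ * (mvfderiv (𝓡∂ (n + 1)) f q u * mvfderiv (𝓡∂ (n + 1)) f q u') := rfl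
    rw [this, hu, hu', hdf q q.2]
    ring
  have hdd : ∀ u : TangentSpace (𝓡 n) y,
      mfderiv (𝓡 n) (𝓡 n) d q (mfderiv (𝓡 n) (𝓡 n) d.symm y u) = u := by
    intro u
    have h1 : mfderiv (𝓡 n) (𝓡 n) (d ∘ d.symm) y u =
        mfderiv (𝓡 n) (𝓡 n) d q (mfderiv (𝓡 n) (𝓡 n) d.symm y u) := by
      rw [mfderiv_comp y (d.contMDiff.mdifferentiableAt (by simp))
        (d.symm.contMDiff.mdifferentiableAt (by simp))]
      rfl
    have h2 : d ∘ d.symm = id := by ext; simp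
    rw [← h1, h2, mfderiv_id]
    rfl
  change morseMetric f G' ζ (q : M) (mfderiv (𝓡 n) (𝓡∂ (n + 1)) (Subtype.val : V → M) q
      (mfderiv (𝓡 n) (𝓡 n) d.symm y v)) (mfderiv (𝓡 n) (𝓡∂ (n + 1)) (Subtype.val : V → M) q
      (mfderiv (𝓡 n) (𝓡 n) d.symm y w)) = h.inner y v w
  rw [hm _ _ (hker _) (hker _), hG' _ _ _ (hker _) (hker _)]
  refine (hG q q.2 _ _).trans ?_
  refine (congrArg₂ (fun a b ↦ h.inner (d q) a b) (hdd v) (hdd w)).trans ?_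
  exact h.inner_congr (by simp [hq]) v w

end GlobalMetric

/-! ### Critical points read in charts -/

section Charts

variable {E : Type*} [NormedAddCommGroup E] [NormedSpace ℝ E]
  {H : Type*} [TopologicalSpace H] {I : ModelWithCorners ℝ E H}
  {M : Type*} [TopologicalSpace M] [ChartedSpace H M]

theorem IsCritPt.neg {f : M → ℝ} {x : M} (h : IsCritPt I f x) : IsCritPt I (-f) x := by
  rw [IsCritPt, mvfderiv_neg]
  rw [h, neg_zero]

theorem IsCritPt.congr {f g : M → ℝ} {x : M} (h : IsCritPt I f x) (hfg : f =ᶠ[𝓝 x] g) :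
    IsCritPt I g x := by
  have h1 := hfg.mfderiv_eq (I := I) (I' := 𝓘(ℝ, ℝ))
  refine ContinuousLinearMap.ext fun v ↦ ?_
  exact (DFunLike.congr_fun h1 v).symm.trans (DFunLike.congr_fun h v)

variable [IsManifold I ∞ M]

/-- At a critical point, the derivative of a function in any chart vanishes. -/
theorem IsCritPt.hasFDerivWithinAt {f : M → ℝ} {c x : M} (hx : x ∈ (chartAt H c).source)
    (hf : MDifferentiableAt I 𝓘(ℝ, ℝ) f x) (hcrit : IsCritPt I f x) :
    HasFDerivWithinAt (f ∘ (extChartAt I c).symm) (0 : E →L[ℝ] ℝ) (range I)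
      (extChartAt I c x) := by
  have hx' : x ∈ (extChartAt I c).source := by rwa [extChartAt_source]
  have hinv : (extChartAt I c).symm (extChartAt I c x) = x := (extChartAt I c).left_inv hx'
  have h1 : MDifferentiableWithinAt 𝓘(ℝ, E) I (extChartAt I c).symm (range I)
      (extChartAt I c x) :=
    (contMDiffWithinAt_extChartAt_symm_range (n := ∞) c
      ((extChartAt I c).map_source hx')).mdifferentiableWithinAt (by simp)
  have h2 : mfderiv I 𝓘(ℝ, ℝ) f x = 0 := ContinuousLinearMap.ext fun v ↦
    DFunLike.congr_fun hcrit v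
  have h3 : HasMFDerivAt I 𝓘(ℝ, ℝ) f ((extChartAt I c).symm (extChartAt I c x))
      (0 : E →L[ℝ] ℝ) := by
    rw [hinv]
    have := hf.hasMFDerivAt
    rwa [h2] at this
  have h4 := h3.comp_hasMFDerivWithinAt _ h1.hasMFDerivWithinAt
  rw [hasMFDerivWithinAt_iff_hasFDerivWithinAt] at h4
  exact h4.congr_fderiv (ContinuousLinearMap.ext fun _ ↦ rfl)

end Charts

/-! ### A function with the right boundary behaviour -/

section BoundaryFunction

variable {n : ℕ} {M : Type*} [TopologicalSpace M] [ChartedSpace (EuclideanHalfSpace (n + 1)) M]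
  [IsManifold (𝓡∂ (n + 1)) ∞ M]

/-- A function which increases at a positive rate away from the boundary is not critical. -/
theorem not_isCritPt_of_le {f : M → ℝ} {c x : M}
    (hx : x ∈ (chartAt (EuclideanHalfSpace (n + 1)) c).source)
    (hxb : x ∈ (𝓡∂ (n + 1)).boundary M) (hf : MDifferentiableAt (𝓡∂ (n + 1)) 𝓘(ℝ, ℝ) f x)
    {a : ℝ} (ha : 0 < a) (h : ∀ᶠ y in 𝓝 x, f x + a * (extChartAt (𝓡∂ (n + 1)) c y) 0 ≤ f y) :
    ¬ IsCritPt (𝓡∂ (n + 1)) f x := by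
  intro hcrit
  set φ := extChartAt (𝓡∂ (n + 1)) c with hφ
  have hx' : x ∈ φ.source := by rwa [hφ, extChartAt_source]
  have h0 : φ x 0 = 0 := (mem_boundary_iff hx).1 hxb
  have hinv : φ.symm (φ x) = x := φ.left_inv hx'
  -- Move inwards along the normal `e`: the one-sided difference quotients of `f` are at least `a`,
  -- whereas criticality makes their limit `0`.
  let e : EuclideanSpace ℝ (Fin (n + 1)) := EuclideanSpace.single 0 1
  have hγ0 : ∀ t : ℝ, (φ x + t • e) 0 = t := fun t ↦ by simp [h0, e]
  have hmaps : MapsTo (fun t : ℝ ↦ φ x + t • e) (Ici 0) (range (𝓡∂ (n + 1))) := fun t ht ↦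
    mem_range_halfSpace.2 (by rw [hγ0]; exact ht)
  have hγ : HasDerivWithinAt (fun t : ℝ ↦ φ x + t • e) e (Ici 0) 0 := by
    simpa using (((hasDerivAt_id (0 : ℝ)).smul_const e).const_add (φ x)).hasDerivWithinAt
  have hg := hcrit.hasFDerivWithinAt hx hf
  rw [← hφ] at hg
  have hF : HasDerivWithinAt ((f ∘ φ.symm) ∘ fun t : ℝ ↦ φ x + t • e) 0 (Ici 0) 0 := by
    have hg' : HasFDerivWithinAt (f ∘ φ.symm) (0 : EuclideanSpace ℝ (Fin (n + 1)) →L[ℝ] ℝ)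
      (range (𝓡∂ (n + 1))) (φ x + (0 : ℝ) • e) := by simpa using hg
    simpa using hg'.comp_hasDerivWithinAt (0 : ℝ) hγ hmaps
  rw [hasDerivWithinAt_iff_tendsto_slope, Ici_sdiff_left] at hF
  have htend : Tendsto (fun t : ℝ ↦ φ x + t • e) (𝓝[Ioi 0] 0) (𝓝[range (𝓡∂ (n + 1))] (φ x)) := by
    have := (hγ.continuousWithinAt.tendsto_nhdsWithin hmaps).mono_left
      (nhdsWithin_mono (0 : ℝ) Ioi_subset_Ici_self)
    simpa using this
  have hsymm : Tendsto φ.symm (𝓝[range (𝓡∂ (n + 1))] (φ x)) (𝓝 x) := by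
    have := (continuousAt_extChartAt_symm' (I := 𝓡∂ (n + 1)) hx').tendsto
    rw [← hφ, hinv] at this
    exact this.mono_left nhdsWithin_le_nhds
  have hlow : ∀ᶠ t in 𝓝[Ioi (0 : ℝ)] 0, a ≤ slope ((f ∘ φ.symm) ∘ fun t : ℝ ↦ φ x + t • e) 0 t := by
    filter_upwards [(hsymm.comp htend).eventually h,
      htend (extChartAt_target_mem_nhdsWithin_of_mem (φ.map_source hx')),
      self_mem_nhdsWithin] with t ht htt htpos
    have htt' : φ (φ.symm (φ x + t • e)) = φ x + t • e := φ.right_inv htt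
    simp only [Function.comp_apply, htt', hγ0] at ht
    have htpos' : 0 < t := htpos
    rw [slope_def_field]
    simp only [Function.comp_apply, zero_smul, add_zero, sub_zero, hinv]
    rw [le_div_iff₀ htpos']
    linarith
  exact absurd (ge_of_tendsto hF hlow) (not_le.2 ha)

/-- A smooth function vanishing exactly on the boundary, with nonzero normal derivative. -/
theorem exists_boundary_function [T2Space M] [SigmaCompactSpace M] :
    ∃ u : M → ℝ, ContMDiff (𝓡∂ (n + 1)) 𝓘(ℝ, ℝ) ∞ u ∧ (∀ x, 0 ≤ u x) ∧
      (∀ x, u x = 0 ↔ x ∈ (𝓡∂ (n + 1)).boundary M) ∧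
      ∀ x ∈ (𝓡∂ (n + 1)).boundary M, ∃ c : M,
        x ∈ (chartAt (EuclideanHalfSpace (n + 1)) c).source ∧ ∃ a > 0,
          ∀ᶠ y in 𝓝 x, a * (extChartAt (𝓡∂ (n + 1)) c y) 0 ≤ u y := by
  obtain ⟨ρ, hρ⟩ := SmoothPartitionOfUnity.exists_isSubordinate_chartAt_source (𝓡∂ (n + 1)) M
  let ξ (c y : M) : ℝ := (extChartAt (𝓡∂ (n + 1)) c y) 0
  have hterm : ∀ c x, 0 ≤ ρ c x * ξ c x := fun c x ↦
    mul_nonneg (ρ.nonneg c x) (extChartAt_zero_nonneg c x)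
  have hfin : ∀ x, (Function.support fun c ↦ ρ c x * ξ c x).Finite := fun x ↦
    (ρ.locallyFinite.point_finite x).subset fun c hc h0 ↦ hc (by
      have h0' : ρ c x = 0 := h0
      change ρ c x * ξ c x = 0
      rw [h0', zero_mul])
  have hle : ∀ c x, ρ c x * ξ c x ≤ ∑ᶠ c, ρ c x * ξ c x := fun c x ↦
    single_le_finsum c (hfin x) fun c ↦ hterm c x
  have hnonneg : ∀ x, 0 ≤ ∑ᶠ c, ρ c x * ξ c x := fun x ↦ finsum_nonneg fun c ↦ hterm c x
  have hpos : ∀ x, ∃ c, 0 < ρ c x ∧ x ∈ (chartAt (EuclideanHalfSpace (n + 1)) c).source := by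
    intro x
    obtain ⟨c, hc⟩ := ρ.exists_pos_of_mem (mem_univ x)
    exact ⟨c, hc, hρ c (subset_tsupport _ hc.ne')⟩
  refine ⟨fun x ↦ ∑ᶠ c, ρ c x * ξ c x, ?_, hnonneg, fun x ↦ ⟨fun h ↦ ?_, fun h ↦ ?_⟩,
    fun x _ ↦ ?_⟩
  · refine ρ.contMDiff_finsum_smul fun c x hx ↦ ?_
    exact (EuclideanSpace.proj (0 : Fin (n + 1)) :
      EuclideanSpace ℝ (Fin (n + 1)) →L[ℝ] ℝ).contDiff.contMDiff.contMDiffAt.comp x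
        (contMDiffAt_extChartAt' (hρ c hx))
  · obtain ⟨c, hc, hx⟩ := hpos x
    refine (mem_boundary_iff hx).2 (le_antisymm ?_ (extChartAt_zero_nonneg c x))
    exact nonpos_of_mul_nonpos_right ((hle c x).trans h.le) hc
  · refine finsum_eq_zero_of_forall_eq_zero fun c ↦ ?_
    by_cases hc : x ∈ tsupport (ρ c)
    · have : ξ c x = 0 := (mem_boundary_iff (hρ c hc)).1 h
      rw [this, mul_zero]
    · rw [image_eq_zero_of_notMem_tsupport hc, zero_mul]
  · obtain ⟨c, hc, hx⟩ := hpos x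
    -- All summands of `u` are nonnegative, so the single summand at `c` bounds `u` from below, and
    -- `ρ c` exceeds half its value at `x` nearby.
    refine ⟨c, hx, ρ c x / 2, half_pos hc, ?_⟩
    filter_upwards [(ρ c).contMDiff.continuous.continuousAt.eventually
      (lt_mem_nhds (half_lt_self hc))] with y hy
    exact (mul_le_mul_of_nonneg_right hy.le (extChartAt_zero_nonneg c y)).trans (hle c y)

/-- A smooth function on a cobordism with the boundary behaviour of a Morse function. -/
theorem exists_boundary_regular_function [T2Space M] [CompactSpace M] {V₀ V₁ : Set M}
    [ChartedSpace (EuclideanSpace ℝ (Fin n)) V₀] [ChartedSpace (EuclideanSpace ℝ (Fin n)) V₁]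
    (hM : IsTriad n V₀ V₁) :
    ∃ f : M → ℝ, ContMDiff (𝓡∂ (n + 1)) 𝓘(ℝ, ℝ) ∞ f ∧ (∀ x ∈ V₀, f x = 0) ∧ (∀ x ∈ V₁, f x = 1) ∧
      (∀ x ∉ (𝓡∂ (n + 1)).boundary M, f x ∈ Ioo (0 : ℝ) 1) ∧
      ∀ x ∈ (𝓡∂ (n + 1)).boundary M, ¬ IsCritPt (𝓡∂ (n + 1)) f x := by
  obtain ⟨u, hu, hu0, hub, hux⟩ := exists_boundary_function (n := n) (M := M)
  obtain ⟨χ, hχ₀, hχ₁, hχ⟩ := exists_contMDiffMap_zero_one_nhds_of_isClosed (n := (⊤ : ℕ∞))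
    (𝓡∂ (n + 1)) hM.isClosed₀ hM.isClosed₁ hM.disjoint
  have hden : ∀ x, 0 < 2 * u x + 1 := fun x ↦ by linarith [hu0 x]
  -- Near `V₀`, where `χ = 0`, this is `u / (2u + 1)`; near `V₁`, where `χ = 1`, it is `1 - u / (2u
  -- + 1)`. Where `u > 0`, the bounds `0 ≤ χ ≤ 1` put it strictly between `0` and `1`.
  have hf : ContMDiff (𝓡∂ (n + 1)) 𝓘(ℝ, ℝ) ∞ (fun x ↦ (u x + χ x) / (2 * u x + 1)) :=
    (hu.add χ.contMDiff).div₀ ((contMDiff_const.mul hu).add contMDiff_const)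
      fun x ↦ (hden x).ne'
  -- With denominator below `2`, the bound `a ξ ≤ u` gives `(a / 2) ξ ≤ u / (2u + 1)`.
  have hsmall : ∀ x, u x = 0 → ∀ᶠ y in 𝓝 x, 2 * u y + 1 < 2 := fun x hx ↦ by
    have : ContinuousAt (fun y ↦ 2 * u y + 1) x :=
      (continuous_const.mul hu.continuous |>.add continuous_const).continuousAt
    exact this.eventually (gt_mem_nhds (by simp [hx]))
  have hχ₀' : ∀ x ∈ V₀, ∀ᶠ y in 𝓝 x, χ y = 0 := fun x hx ↦
    Filter.eventually_of_mem (mem_nhdsSet_iff_forall.1 hχ₀ x hx) fun y hy ↦ hy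
  have hχ₁' : ∀ x ∈ V₁, ∀ᶠ y in 𝓝 x, χ y = 1 := fun x hx ↦
    Filter.eventually_of_mem (mem_nhdsSet_iff_forall.1 hχ₁ x hx) fun y hy ↦ hy
  have hu₀ : ∀ x ∈ V₀, u x = 0 := fun x hx ↦ (hub x).2 (hM.boundary_eq ▸ Or.inl hx)
  have hu₁ : ∀ x ∈ V₁, u x = 0 := fun x hx ↦ (hub x).2 (hM.boundary_eq ▸ Or.inr hx)
  refine ⟨_, hf, fun x hx ↦ ?_, fun x hx ↦ ?_, fun x hx ↦ ?_, fun x hx ↦ ?_⟩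
  · simp [hu₀ x hx, (hχ₀' x hx).self_of_nhds]
  · simp [hu₁ x hx, (hχ₁' x hx).self_of_nhds]
  · have h1 : 0 < u x := lt_of_le_of_ne (hu0 x) fun h ↦ hx ((hub x).1 h.symm)
    have h2 := hχ x
    refine ⟨div_pos (by linarith [h2.1]) (hden x), ?_⟩
    rw [div_lt_one (hden x)]
    linarith [h2.2]
  · obtain ⟨c, hxc, a, ha, hev⟩ := hux x hx
    rcases (hM.boundary_eq ▸ hx : x ∈ V₀ ∪ V₁) with hxV | hxV
    · refine not_isCritPt_of_le hxc hx (hf.mdifferentiableAt (by simp)) (half_pos ha) ?_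
      filter_upwards [hev, hsmall x (hu₀ x hxV), hχ₀' x hxV] with y h1 h2 h3
      rw [hu₀ x hxV, (hχ₀' x hxV).self_of_nhds, h3, add_zero, zero_div, zero_add, add_zero,
        le_div_iff₀ (hden y)]
      nlinarith [mul_nonneg ha.le (extChartAt_zero_nonneg (n := n) c y), hu0 y]
    · intro hcrit
      refine not_isCritPt_of_le hxc hx (hf.neg.mdifferentiableAt (by simp)) (half_pos ha) ?_
        hcrit.neg
      filter_upwards [hev, hsmall x (hu₁ x hxV), hχ₁' x hxV] with y h1 h2 h3
      rw [hu₁ x hxV, (hχ₁' x hxV).self_of_nhds, h3]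
      have h4 : (u y + 1) / (2 * u y + 1) = 1 - u y / (2 * u y + 1) := by
        have := (hden y).ne'
        rw [eq_sub_iff_add_eq, ← add_div, div_eq_one_iff_eq this]
        ring
      have h5 : a / 2 * (extChartAt (𝓡∂ (n + 1)) c y) 0 ≤ u y / (2 * u y + 1) := by
        rw [le_div_iff₀ (hden y)]
        nlinarith [mul_nonneg ha.le (extChartAt_zero_nonneg (n := n) c y), hu0 y]
      rw [h4]
      linarith

end BoundaryFunction

/-! ### Nondegenerate critical points in Euclidean space -/

section Euclidean

variable {E : Type*} [NormedAddCommGroup E] [NormedSpace ℝ E]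

/-- The second derivative of a composition at a critical point. -/
theorem fderiv_fderiv_comp_of_critical {E' : Type*} [NormedAddCommGroup E'] [NormedSpace ℝ E']
    {u : E' → ℝ} {τ : E → E'} {p : E} (hu : ContDiffAt ℝ ∞ u (τ p)) (hτ : ContDiffAt ℝ ∞ τ p)
    (hcrit : fderiv ℝ u (τ p) = 0) (v w : E) :
    fderiv ℝ (fderiv ℝ (u ∘ τ)) p v w =
      fderiv ℝ (fderiv ℝ u) (τ p) (fderiv ℝ τ p v) (fderiv ℝ τ p w) := by
  have h1 : fderiv ℝ (u ∘ τ) =ᶠ[𝓝 p] fun q ↦ (fderiv ℝ u (τ q)).comp (fderiv ℝ τ q) := by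
    have hu' : ∀ᶠ z in 𝓝 (τ p), ContDiffAt ℝ 1 u z :=
      (hu.of_le (by exact_mod_cast le_top)).eventually (by simp)
    have hτ' : ∀ᶠ z in 𝓝 p, ContDiffAt ℝ 1 τ z :=
      (hτ.of_le (by exact_mod_cast le_top)).eventually (by simp)
    filter_upwards [hτ.continuousAt.eventually hu', hτ'] with q h2 h3
    exact fderiv_comp q (h2.differentiableAt (by simp)) (h3.differentiableAt (by simp))
  have hu2 : DifferentiableAt ℝ (fderiv ℝ u) (τ p) :=
    (hu.fderiv_right (m := ∞) (by simp)).differentiableAt (by simp)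
  have hτ2 : DifferentiableAt ℝ (fderiv ℝ τ) p :=
    (hτ.fderiv_right (m := ∞) (by simp)).differentiableAt (by simp)
  have h4 : HasFDerivAt (fun q ↦ fderiv ℝ u (τ q))
      ((fderiv ℝ (fderiv ℝ u) (τ p)).comp (fderiv ℝ τ p)) p :=
    hu2.hasFDerivAt.comp p (hτ.differentiableAt (by simp)).hasFDerivAt
  -- The product rule gives a further term with the second derivative of `τ`, but it is paired with
  -- `du`, which vanishes at `τ p`.
  rw [h1.fderiv_eq, (h4.clm_comp hτ2.hasFDerivAt).fderiv]
  simp only [add_apply, ContinuousLinearMap.comp_apply, ContinuousLinearMap.compL_apply,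
    ContinuousLinearMap.flip_apply, hcrit, ContinuousLinearMap.zero_comp, zero_add]

/-- The condition that all critical points in a compact set are nondegenerate is open in a smooth
family of functions. -/
theorem isOpen_setOf_nondegenerate [FiniteDimensional ℝ E] {A : Type*} [NormedAddCommGroup A]
    [NormedSpace ℝ A] {u : A → E → ℝ} {L : Set E} (hL : IsCompact L)
    (hu : ∀ a, ∀ y ∈ L, ContDiffAt ℝ ∞ (Function.uncurry u) (a, y)) :
    IsOpen {a | ∀ y ∈ L, fderiv ℝ (u a) y = 0 →
      Function.Injective (fderiv ℝ (fderiv ℝ (u a)) y)} := by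
  rw [isOpen_iff_mem_nhds]
  intro a ha
  refine hL.eventually_forall_of_forall_eventually fun y hy ↦ ?_
  have hF : ContDiffAt ℝ ∞ (fun z : A × E ↦ fderiv ℝ (u z.1) z.2) (a, y) := by
    refine ContDiffAt.fderiv (f := fun z : A × E ↦ u z.1) (n := ∞) ?_ contDiffAt_snd (by simp)
    exact (hu a y hy).comp ((a, y), y) (f := fun z : (A × E) × E ↦ (z.1.1, z.2)) (by fun_prop)
  have hF2 : ContDiffAt ℝ ∞ (fun z : A × E ↦ fderiv ℝ (fderiv ℝ (u z.1)) z.2) (a, y) := by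
    refine ContDiffAt.fderiv (f := fun z : A × E ↦ fderiv ℝ (u z.1)) (n := ∞) ?_ contDiffAt_snd
      (by simp)
    exact hF.comp ((a, y), y) (f := fun z : (A × E) × E ↦ (z.1.1, z.2)) (by fun_prop)
  -- At a critical point the Hessian is injective, an open condition on operators in finite
  -- dimension; elsewhere noncriticality persists.
  by_cases h0 : fderiv ℝ (u a) y = 0
  · have hinj : ∀ᶠ T : E →L[ℝ] E →L[ℝ] ℝ in 𝓝 (fderiv ℝ (fderiv ℝ (u a)) y), Function.Injective T :=
      ContinuousLinearMap.isOpen_injective.mem_nhds (ha y hy h0)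
    exact (hF2.continuousAt.eventually hinj).mono fun z hz _ ↦ hz
  · exact (hF.continuousAt.eventually_ne h0).mono fun z hz h ↦ absurd h hz

/-- Almost every linear perturbation of a smooth function has only nondegenerate critical
points. -/
theorem dense_setOf_nondegenerate {m : ℕ} {u : EuclideanSpace ℝ (Fin m) → ℝ}
    {Ω : Set (EuclideanSpace ℝ (Fin m))} (hu : ∀ y ∈ Ω, ContDiffAt ℝ ∞ u y) :
    Dense {b : EuclideanSpace ℝ (Fin m) | ∀ y ∈ Ω, fderiv ℝ (fun y ↦ u y + inner ℝ b y) y = 0 →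
      Function.Injective (fderiv ℝ (fderiv ℝ (fun y ↦ u y + inner ℝ b y)) y)} := by
  let E := EuclideanSpace ℝ (Fin m)
  let D : (E →L[ℝ] ℝ) →L[ℝ] E := -((InnerProductSpace.toDual ℝ E).symm :
    (E →L[ℝ] ℝ) →L⋆[ℝ] E)
  -- This is `-∇u`: a point `y` is critical for `u + ⟨b, ·⟩` exactly when `g y = b`, and, the linear
  -- term not affecting second derivatives, it is degenerate when `det (g' y) = 0`. Such `b` form a
  -- null set, by Sard's theorem in equal dimensions.
  let g : E → E := fun y ↦ D (fderiv ℝ u y)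
  have hu2 : ∀ y ∈ Ω, DifferentiableAt ℝ (fderiv ℝ u) y := fun y hy ↦
    ((hu y hy).fderiv_right (m := ∞) (by simp)).differentiableAt (by simp)
  let g' : E → E →L[ℝ] E := fun y ↦ D.comp (fderiv ℝ (fderiv ℝ u) y)
  have hg : ∀ y ∈ Ω, HasFDerivAt g (g' y) y := fun y hy ↦
    D.hasFDerivAt.comp y (hu2 y hy).hasFDerivAt
  let s : Set E := {y ∈ Ω | (g' y).det = 0}
  have hnull : MeasureTheory.volume (g '' s) = 0 :=
    MeasureTheory.addHaar_image_eq_zero_of_det_fderivWithin_eq_zero MeasureTheory.volume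
      (fun y hy ↦ (hg y hy.1).hasFDerivWithinAt) fun y hy ↦ hy.2
  refine (MeasureTheory.Measure.dense_of_ae (μ := MeasureTheory.volume) (p := fun b ↦ b ∉ g '' s)
    (MeasureTheory.measure_eq_zero_iff_ae_notMem.1 hnull)).mono fun b hb y hy hcrit ↦ ?_
  have hadd : ∀ z, DifferentiableAt ℝ u z →
      fderiv ℝ (fun y ↦ u y + inner ℝ b y) z = fderiv ℝ u z + innerSL ℝ b := fun z hz ↦
    (hz.hasFDerivAt.add (innerSL ℝ b).hasFDerivAt).fderiv
  have hadd2 : fderiv ℝ (fderiv ℝ (fun y ↦ u y + inner ℝ b y)) y = fderiv ℝ (fderiv ℝ u) y := by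
    have hev : fderiv ℝ (fun y ↦ u y + inner ℝ b y) =ᶠ[𝓝 y]
        fun z ↦ fderiv ℝ u z + innerSL ℝ b := by
      have h1 : ∀ᶠ z in 𝓝 y, ContDiffAt ℝ 1 u z :=
        ((hu y hy).of_le (by exact_mod_cast le_top)).eventually (by simp)
      filter_upwards [h1] with z hz
      exact hadd z (hz.differentiableAt (by simp))
    rw [hev.fderiv_eq, fderiv_add_const]
  rw [hadd y ((hu y hy).differentiableAt (by simp))] at hcrit
  have hgy : g y = b := by
    have h1 : fderiv ℝ u y = -innerSL ℝ b := eq_neg_of_add_eq_zero_left hcrit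
    have h2 : innerSL ℝ b = InnerProductSpace.toDual ℝ E b := rfl
    simp only [g, D, h1, h2]
    simp
    exact neg_neg b
  have hdet : (g' y).det ≠ 0 := fun h ↦ hb ⟨y, ⟨hy, h⟩, hgy⟩
  rw [hadd2]
  intro v w hvw
  have hker : (g' y : E →ₗ[ℝ] E).ker = ⊥ := by
    by_contra hne
    exact hdet (LinearMap.det_eq_zero_iff_ker_ne_bot.2 hne)
  exact LinearMap.ker_eq_bot.1 hker (congrArg D hvw)

end Euclidean

/-! ### Hessians at interior points and isolation of critical points -/

section Charts

variable {E : Type*} [NormedAddCommGroup E] [NormedSpace ℝ E]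
  {H : Type*} [TopologicalSpace H] {I : ModelWithCorners ℝ E H}
  {M : Type*} [TopologicalSpace M] [ChartedSpace H M] [IsManifold I ∞ M]

theorem range_mem_nhds_of_isInteriorPoint {c x : M} (hx : x ∈ (chartAt H c).source)
    (hi : I.IsInteriorPoint x) : range I ∈ 𝓝 (extChartAt I c x) :=
  mem_interior_iff_mem_nhds.1 (interior_mono (extChartAt_target_subset_range c)
    ((I.isInteriorPoint_iff_of_mem_atlas (n := ∞) (by simp) (chart_mem_atlas H c) hx).1 hi))

theorem extChartAt_target_mem_nhds_of_isInteriorPoint {c x : M} (hx : x ∈ (chartAt H c).source)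
    (hi : I.IsInteriorPoint x) : (extChartAt I c).target ∈ 𝓝 (extChartAt I c x) :=
  mem_interior_iff_mem_nhds.1
    ((I.isInteriorPoint_iff_of_mem_atlas (n := ∞) (by simp) (chart_mem_atlas H c) hx).1 hi)

theorem contMDiffAt_extChartAt_symm_of_isInteriorPoint {c x : M} (hx : x ∈ (chartAt H c).source)
    (hi : I.IsInteriorPoint x) :
    ContMDiffAt 𝓘(ℝ, E) I ∞ (extChartAt I c).symm (extChartAt I c x) :=
  (contMDiffOn_extChartAt_symm c).contMDiffAt (extChartAt_target_mem_nhds_of_isInteriorPoint hx hi)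

theorem contDiffAt_comp_extChartAt_symm {F : Type*} [NormedAddCommGroup F] [NormedSpace ℝ F]
    {f : M → F} {c x : M} (hx : x ∈ (chartAt H c).source) (hi : I.IsInteriorPoint x)
    (hf : ContMDiff I 𝓘(ℝ, F) ∞ f) :
    ContDiffAt ℝ ∞ (f ∘ (extChartAt I c).symm) (extChartAt I c x) :=
  (hf.contMDiffAt.comp _ (contMDiffAt_extChartAt_symm_of_isInteriorPoint hx hi)).contDiffAt

theorem IsCritPt.fderiv_eq_zero {f : M → ℝ} {c x : M} (hx : x ∈ (chartAt H c).source)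
    (hi : I.IsInteriorPoint x) (hf : MDifferentiableAt I 𝓘(ℝ, ℝ) f x) (hcrit : IsCritPt I f x) :
    fderiv ℝ (f ∘ (extChartAt I c).symm) (extChartAt I c x) = 0 :=
  ((hcrit.hasFDerivWithinAt hx hf).hasFDerivAt (range_mem_nhds_of_isInteriorPoint hx hi)).fderiv

/-- `range I` is a neighbourhood of the image point and of all points near it, so both derivatives
within it are ordinary ones. -/
theorem hessian_eq_of_isInteriorPoint (f : M → ℝ) {x : M} (hi : I.IsInteriorPoint x) :
    hessian I f x = fderiv ℝ (fderiv ℝ (f ∘ (extChartAt I x).symm)) (extChartAt I x x) := by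
  have h := range_mem_nhds_of_isInteriorPoint (mem_chart_source H x) hi
  rw [hessian, fderivWithin_of_mem_nhds h]
  refine Filter.EventuallyEq.fderiv_eq ?_
  filter_upwards [eventually_mem_nhds_iff.2 h] with y hy
  exact fderivWithin_of_mem_nhds hy

/-- Nondegeneracy of the Hessian at a critical point can be checked in any chart. -/
theorem injective_hessian [FiniteDimensional ℝ E] {f : M → ℝ} {c x : M}
    (hx : x ∈ (chartAt H c).source) (hi : I.IsInteriorPoint x) (hf : ContMDiff I 𝓘(ℝ, ℝ) ∞ f)
    (hcrit : IsCritPt I f x)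
    (hinj : Function.Injective
      (fderiv ℝ (fderiv ℝ (f ∘ (extChartAt I c).symm)) (extChartAt I c x))) :
    Function.Injective (hessian I f x) := by
  set φ := extChartAt I c with hφ
  set ψ := extChartAt I x with hψ
  have hxφ : x ∈ φ.source := by rwa [hφ, extChartAt_source]
  have hxψ : x ∈ ψ.source := mem_extChartAt_source x
  let τ : E → E := φ ∘ ψ.symm
  let σ : E → E := ψ ∘ φ.symm
  have hψx : ψ.symm (ψ x) = x := ψ.left_inv hxψ
  have hφx : φ.symm (φ x) = x := φ.left_inv hxφ
  have hτx : τ (ψ x) = φ x := congrArg φ hψx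
  have hτ : ContDiffAt ℝ ∞ τ (ψ x) := by
    refine (ContMDiffAt.comp (ψ x) (g := φ) (I' := I) ?_
      (contMDiffAt_extChartAt_symm_of_isInteriorPoint (mem_chart_source H x) hi)).contDiffAt
    rw [← hψ, hψx]
    exact contMDiffAt_extChartAt' hx
  have hσ : ContDiffAt ℝ ∞ σ (φ x) := by
    refine (ContMDiffAt.comp (φ x) (g := ψ) (I' := I) ?_
      (contMDiffAt_extChartAt_symm_of_isInteriorPoint hx hi)).contDiffAt
    rw [← hφ, hφx]
    exact contMDiffAt_extChartAt
  have hcont : ContinuousAt ψ.symm (ψ x) :=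
    continuousAt_extChartAt_symm (I := I) x
  have hev : ∀ᶠ y in 𝓝 (ψ x), φ.symm (τ y) = ψ.symm y := by
    have h1 : ∀ᶠ z in 𝓝 (ψ.symm (ψ x)), z ∈ φ.source := by
      rw [hψx]
      exact extChartAt_source_mem_nhds' hxφ
    filter_upwards [hcont.eventually h1] with y hy
    exact φ.left_inv hy
  have hστ : σ ∘ τ =ᶠ[𝓝 (ψ x)] id := by
    filter_upwards [hev, extChartAt_target_mem_nhds_of_isInteriorPoint (mem_chart_source H x) hi]
      with y hy hy'
    change ψ (φ.symm (τ y)) = y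
    rw [hy]
    exact ψ.right_inv hy'
  have hleft : ∀ v : E, fderiv ℝ σ (φ x) (fderiv ℝ τ (ψ x) v) = v := by
    intro v
    have h1 := hστ.fderiv_eq (𝕜 := ℝ)
    rw [fderiv_comp (ψ x) (by rw [hτx]; exact hσ.differentiableAt (by simp))
      (hτ.differentiableAt (by simp)), hτx, fderiv_id] at h1
    exact DFunLike.congr_fun h1 v
  -- The derivative of the transition map is bijective, and at a critical point it carries one
  -- Hessian to the other.
  have hτinj : Function.Injective (fderiv ℝ τ (ψ x)) := Function.LeftInverse.injective hleft
  have hτsurj : Function.Surjective (fderiv ℝ τ (ψ x)) :=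
    LinearMap.injective_iff_surjective (f := (fderiv ℝ τ (ψ x) : E →ₗ[ℝ] E)).1 hτinj
  have hfev : f ∘ ψ.symm =ᶠ[𝓝 (ψ x)] (f ∘ φ.symm) ∘ τ := by
    filter_upwards [hev] with y hy
    simp only [Function.comp_apply, hy]
  have hD : fderiv ℝ (fderiv ℝ (f ∘ ψ.symm)) (ψ x) =
      fderiv ℝ (fderiv ℝ ((f ∘ φ.symm) ∘ τ)) (ψ x) := hfev.fderiv.fderiv_eq
  have hcomp : ∀ v w, hessian I f x v w = fderiv ℝ (fderiv ℝ (f ∘ φ.symm)) (φ x)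
      (fderiv ℝ τ (ψ x) v) (fderiv ℝ τ (ψ x) w) := by
    intro v w
    rw [hessian_eq_of_isInteriorPoint f hi, hD, fderiv_fderiv_comp_of_critical _ hτ, hτx]
    · rw [hτx]
      exact hcrit.fderiv_eq_zero hx hi (hf.mdifferentiableAt (by simp))
    · rw [hτx]
      exact contDiffAt_comp_extChartAt_symm hx hi hf
  intro v v' hvv
  refine hτinj (hinj (ContinuousLinearMap.ext fun w ↦ ?_))
  obtain ⟨w, rfl⟩ := hτsurj w
  rw [← hcomp, ← hcomp, hvv]

/-- Nondegenerate critical points in the interior are isolated. -/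
theorem eventually_not_isCritPt_of_injective_hessian [FiniteDimensional ℝ E] {f : M → ℝ} {x : M}
    (hi : I.IsInteriorPoint x) (hf : ContMDiff I 𝓘(ℝ, ℝ) ∞ f)
    (hinj : Function.Injective (hessian I f x)) : ∀ᶠ y in 𝓝[≠] x, ¬ IsCritPt I f y := by
  set φ := extChartAt I x with hφ
  have hu := contDiffAt_comp_extChartAt_symm (mem_chart_source H x) hi hf
  have hd : HasFDerivAt (fderiv ℝ (f ∘ φ.symm)) (hessian I f x) (φ x) := by
    rw [hessian_eq_of_isInteriorPoint f hi]
    exact ((hu.fderiv_right (m := ∞) (by simp)).differentiableAt (by simp)).hasFDerivAt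
  -- An injective Hessian is bounded below, so the differential in the chart, vanishing at `φ x`, is
  -- nonzero at all other nearby points.
  obtain ⟨K, -, hK⟩ := (hessian I f x).toLinearMap.exists_antilipschitzWith
    (LinearMap.ker_eq_bot.2 hinj)
  have h1 : ∀ᶠ z in 𝓝[≠] φ x, fderiv ℝ (f ∘ φ.symm) z ≠ 0 :=
    hd.eventually_ne ⟨K, hK⟩
  have h2 : Tendsto φ (𝓝[≠] x) (𝓝[≠] φ x) := by
    refine tendsto_nhdsWithin_iff.2 ⟨(continuousAt_extChartAt x).mono_left nhdsWithin_le_nhds, ?_⟩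
    filter_upwards [self_mem_nhdsWithin,
      mem_nhdsWithin_of_mem_nhds (extChartAt_source_mem_nhds (I := I) x)] with y hy hys heq
    exact hy (φ.injOn hys (mem_extChartAt_source x) heq)
  have h3 : ∀ᶠ y in 𝓝 x, I.IsInteriorPoint y :=
    I.isOpen_interior (n := ∞) (by simp) |>.mem_nhds hi
  filter_upwards [h2.eventually h1, mem_nhdsWithin_of_mem_nhds h3,
    mem_nhdsWithin_of_mem_nhds ((chartAt H x).open_source.mem_nhds (mem_chart_source H x))]
    with y hy hyi hys hcrit
  exact hy (hcrit.fderiv_eq_zero hys hyi (hf.mdifferentiableAt (by simp)))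

/-- In a smooth family of functions, being noncritical is an open condition. -/
theorem eventually_not_isCritPt {A : Type*} [NormedAddCommGroup A] [NormedSpace ℝ A]
    {F : A → M → ℝ} (hF : ContMDiff (𝓘(ℝ, A).prod I) 𝓘(ℝ, ℝ) ∞ (Function.uncurry F)) {a : A}
    {x : M} (hx : ¬ IsCritPt I (F a) x) : ∀ᶠ z in 𝓝 (a, x), ¬ IsCritPt I (F z.1) z.2 := by
  -- Read in trivializations, the differential of `F a` at `x` depends continuously on `(a, x)`;
  -- criticality is its vanishing.
  have h := ContMDiffAt.mfderiv (I := I) (I' := 𝓘(ℝ, ℝ)) (J := 𝓘(ℝ, A).prod I) (n := ∞) (m := ∞)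
    (x₀ := (a, x)) (fun z : A × M ↦ F z.1) (fun z : A × M ↦ z.2)
    (by
      refine ContMDiffAt.comp (I' := 𝓘(ℝ, A).prod I) (g := Function.uncurry F)
        (f := fun p : (A × M) × M ↦ (p.1.1, p.2)) _ hF.contMDiffAt ?_
      exact (contMDiffAt_fst.comp _ contMDiffAt_fst).prodMk contMDiffAt_snd)
    contMDiffAt_snd (by simp)
  have h0 : ∀ z : A × M, inTangentCoordinates I 𝓘(ℝ, ℝ) (fun z : A × M ↦ z.2)
      (fun z : A × M ↦ F z.1 z.2) (fun z ↦ mfderiv I 𝓘(ℝ, ℝ) (F z.1) z.2) (a, x) z = 0 →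
      z.2 ∈ (chartAt H x).source → IsCritPt I (F z.1) z.2 := by
    intro z hz hzs
    have hz' := (ContinuousLinearMap.inCoordinates_eq (ϕ := mfderiv I 𝓘(ℝ, ℝ) (F z.1) z.2) hzs
      (FiberBundle.mem_baseSet_trivializationAt' (F := ℝ)
        (E := fun y : ℝ ↦ TangentSpace 𝓘(ℝ, ℝ) y) _)).symm.trans hz
    refine ContinuousLinearMap.ext fun v ↦ ?_
    let e := (trivializationAt E (TangentSpace I) x).continuousLinearEquivAt ℝ z.2 hzs
    have h3 : mfderiv I 𝓘(ℝ, ℝ) (F z.1) z.2 (e.symm (e v)) = 0 :=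
      (ContinuousLinearEquiv.map_eq_zero_iff ((trivializationAt ℝ
        (TangentSpace 𝓘(ℝ, ℝ)) (F z.1 z.2)).continuousLinearEquivAt ℝ (F z.1 z.2)
          (FiberBundle.mem_baseSet_trivializationAt' _))).1
        (DFunLike.congr_fun hz' (e v))
    rw [ContinuousLinearEquiv.symm_apply_apply] at h3
    exact h3
  have h1 : ∀ z : A × M, IsCritPt I (F z.1) z.2 → inTangentCoordinates I 𝓘(ℝ, ℝ)
      (fun z : A × M ↦ z.2) (fun z : A × M ↦ F z.1 z.2)
      (fun z ↦ mfderiv I 𝓘(ℝ, ℝ) (F z.1) z.2) (a, x) z = 0 := by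
    intro z hz
    have h2 : mfderiv I 𝓘(ℝ, ℝ) (F z.1) z.2 = 0 := ContinuousLinearMap.ext fun v ↦
      DFunLike.congr_fun hz v
    change ContinuousLinearMap.inCoordinates E (TangentSpace I) ℝ (TangentSpace 𝓘(ℝ, ℝ)) _ _ _ _
      (mfderiv I 𝓘(ℝ, ℝ) (F z.1) z.2) = 0
    rw [h2, ContinuousLinearMap.inCoordinates]
    simp only [ContinuousLinearMap.zero_comp, ContinuousLinearMap.comp_zero]
  exact (h.continuousAt.eventually_ne fun h2 ↦ hx (h0 (a, x) h2 (mem_chart_source H x))).mono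
    fun z hz hcrit ↦ hz (h1 z hcrit)

end Charts

/-! ### Perturbation to a Morse function -/

section Perturbation

variable {m : ℕ} {H : Type*} [TopologicalSpace H]
  {I : ModelWithCorners ℝ (EuclideanSpace ℝ (Fin m)) H}
  {M : Type*} [TopologicalSpace M] [ChartedSpace H M] [IsManifold I ∞ M]

/-- A compactly supported smooth map agreeing with the chart near a given interior point. -/
theorem exists_localized_chart [T2Space M] [CompactSpace M] {x : M} (hi : I.IsInteriorPoint x) :
    ∃ (θ : M → EuclideanSpace ℝ (Fin m)) (L : Set M),
      ContMDiff I 𝓘(ℝ, EuclideanSpace ℝ (Fin m)) ∞ θ ∧ tsupport θ ⊆ I.interior M ∧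
      IsCompact L ∧ L ∈ 𝓝 x ∧ L ⊆ (chartAt H x).source ∩ I.interior M ∧
      ∀ y ∈ L, ∀ᶠ z in 𝓝 y, θ z = extChartAt I x z := by
  have hint : I.interior M ∈ 𝓝 x := (I.isOpen_interior (n := ∞) (by simp)).mem_nhds hi
  obtain ⟨ψ, -, hψ⟩ := (SmoothBumpFunction.nhds_basis_tsupport (I := I) x).mem_iff.1 hint
  -- Keeping `L` where the bump function is locally `1` makes `θ` equal to the chart near every
  -- point of `L`, so their derivatives agree there.
  have hU : {y | ∀ᶠ z in 𝓝 y, ψ z = 1} ∩ ((chartAt H x).source ∩ I.interior M) ∈ 𝓝 x :=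
    inter_mem (eventually_eventually_nhds.2 ψ.eventuallyEq_one)
      (inter_mem ((chartAt H x).open_source.mem_nhds (mem_chart_source H x)) hint)
  obtain ⟨L, hLx, hLU, hL⟩ := local_compact_nhds hU
  refine ⟨fun y ↦ ψ y • extChartAt I x y, L, ψ.contMDiff_smul contMDiffOn_extChartAt,
    (tsupport_smul_subset_left _ _).trans hψ, hL, hLx, fun y hy ↦ (hLU hy).2, fun y hy ↦ ?_⟩
  filter_upwards [(hLU hy).1] with z hz
  rw [hz, one_smul]

/-- A smooth function on a compact manifold without critical points on the boundary and with
values in `(0, 1)` in the interior is a Morse function after a perturbation in the interior. -/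
theorem exists_isMorse_perturbation [T2Space M] [CompactSpace M] {f : M → ℝ}
    (hf : ContMDiff I 𝓘(ℝ, ℝ) ∞ f) (hb : ∀ x ∈ I.boundary M, ¬ IsCritPt I f x)
    (h01 : ∀ x ∉ I.boundary M, f x ∈ Ioo (0 : ℝ) 1) :
    ∃ g, IsMorse I g ∧ (∀ x ∈ I.boundary M, g =ᶠ[𝓝 x] f) ∧
      ∀ x ∉ I.boundary M, g x ∈ Ioo (0 : ℝ) 1 := by
  classical
  let E := EuclideanSpace ℝ (Fin m)
  have hmem : ∀ {x : M}, x ∉ I.boundary M → x ∈ I.interior M := fun {x} hx ↦ by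
    by_contra h
    exact hx (by rwa [← I.compl_interior])
  have hclosed : ∀ g : M → ℝ, ContMDiff I 𝓘(ℝ, ℝ) ∞ g → IsCompact {x | IsCritPt I g x} := by
    intro g hg
    refine IsClosed.isCompact (isOpen_compl_iff.1 (isOpen_iff_mem_nhds.2 fun x hx ↦ ?_))
    have := eventually_not_isCritPt (A := ℝ) (F := fun _ ↦ g) (a := 0) (hg.comp contMDiff_snd) hx
    exact this.curry_nhds.self_of_nhds
  have hloc : ∀ x : M, x ∈ I.interior M → ∃ (θ : M → E) (L : Set M),
      ContMDiff I 𝓘(ℝ, E) ∞ θ ∧ tsupport θ ⊆ I.interior M ∧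
      IsCompact L ∧ L ∈ 𝓝 x ∧ L ⊆ (chartAt H x).source ∩ I.interior M ∧
      ∀ y ∈ L, ∀ᶠ z in 𝓝 y, θ z = extChartAt I x z := fun x hx ↦ exists_localized_chart hx
  choose! θ L hθ hθs hLc hLx hLs hθL using hloc
  have hcritint : ∀ x, IsCritPt I f x → x ∈ I.interior M := fun x hx ↦ hmem fun h ↦ hb x h hx
  obtain ⟨t, htK, htcov⟩ := (hclosed f hf).elim_nhds_subcover (fun x ↦ interior (L x))
    fun x hx ↦ interior_mem_nhds.2 (hLx x (hcritint x hx))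
  have hti : ∀ i : t, (i : M) ∈ I.interior M := fun i ↦ hcritint i (htK i i.2)
  -- The interiors of finitely many sets `L i` cover the critical set of `f`. On `L i` the `i`-th
  -- parameter adds a linear function of the chart coordinates.
  let F : (t → E) → M → ℝ := fun a y ↦ f y + ∑ i : t, inner ℝ (a i) (θ i y)
  have hF0 : F 0 = f := by
    funext y
    simp [F]
  have hF : ContMDiff (𝓘(ℝ, t → E).prod I) 𝓘(ℝ, ℝ) ∞ (Function.uncurry F) := by
    refine (hf.comp contMDiff_snd).add (contMDiff_finsetSum fun i _ ↦ ?_)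
    have h1 : ContMDiff (𝓘(ℝ, t → E).prod I) 𝓘(ℝ, E) ∞ fun z : (t → E) × M ↦ z.1 i :=
      (ContinuousLinearMap.proj (R := ℝ) (φ := fun _ : t ↦ E) i).contMDiff.comp contMDiff_fst
    have h2 : ContMDiff (𝓘(ℝ, t → E).prod I) 𝓘(ℝ, E) ∞ fun z : (t → E) × M ↦ θ i z.2 :=
      (hθ i (hti i)).comp contMDiff_snd
    exact (contDiff_inner (𝕜 := ℝ) (E := E)).contMDiff.comp (h1.prodMk_space h2)
  have hFa : ∀ a, ContMDiff I 𝓘(ℝ, ℝ) ∞ (F a) := fun a ↦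
    hF.comp (contMDiff_const.prodMk contMDiff_id)
  let u : t → (t → E) → E → ℝ := fun i a ↦ F a ∘ (extChartAt I (i : M)).symm
  let Good : t → Set (t → E) := fun i ↦ {a | ∀ y ∈ extChartAt I (i : M) '' L i,
    fderiv ℝ (u i a) y = 0 → Function.Injective (fderiv ℝ (fderiv ℝ (u i a)) y)}
  have hopen : ∀ i, IsOpen (Good i) := by
    intro i
    refine isOpen_setOf_nondegenerate ((hLc i (hti i)).image_of_continuousOn
      ((continuousOn_extChartAt (I := I) (i : M)).mono fun y hy ↦ ?_)) ?_
    · rw [extChartAt_source]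
      exact (hLs i (hti i) hy).1
    · rintro a _ ⟨y, hy, rfl⟩
      have hy' := hLs i (hti i) hy
      have h1 : ∀ {G : Type} [NormedAddCommGroup G] [NormedSpace ℝ G] (k : M → G),
          ContMDiff I 𝓘(ℝ, G) ∞ k → ContDiffAt ℝ ∞
            (fun z : (t → E) × E ↦ k ((extChartAt I (i : M)).symm z.2))
            (a, extChartAt I (i : M) y) := fun k hk ↦
        ContDiffAt.comp (g := k ∘ (extChartAt I (i : M)).symm) (a, extChartAt I (i : M) y)
          (contDiffAt_comp_extChartAt_symm hy'.1 hy'.2 hk) contDiffAt_snd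
      refine (h1 f hf).add (ContDiffAt.sum fun j _ ↦ ?_)
      exact ContDiffAt.inner ℝ (by fun_prop) (h1 _ (hθ j (hti j)))
  have hdense : ∀ i, Dense (Good i) := by
    intro i a
    have hD := dense_setOf_nondegenerate (u := u i a) (Ω := extChartAt I (i : M) '' L i) (by
      rintro _ ⟨y, hy, rfl⟩
      have hy' := hLs i (hti i) hy
      exact contDiffAt_comp_extChartAt_symm hy'.1 hy'.2 (hFa a))
    -- Varying only the `i`-th parameter about `a` perturbs `u i a` linearly near the image of `L
    -- i`, so arbitrarily small good values exist.
    have hcont : Continuous fun b : E ↦ a + (Pi.single i b : t → E) :=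
      continuous_const.add (continuous_single (A := fun _ : t ↦ E) i)
    have h0 := map_mem_closure hcont (hD 0) (t := Good i) (fun b hb ↦ ?_)
    · simpa using h0
    rintro _ ⟨y, hy, rfl⟩
    have hy' := hLs i (hti i) hy
    have hev : u i (a + Pi.single i b) =ᶠ[𝓝 (extChartAt I (i : M) y)]
        fun z ↦ u i a z + inner ℝ b z := by
      have hys : y ∈ (extChartAt I (i : M)).source := by rw [extChartAt_source]; exact hy'.1
      have htend : Tendsto (extChartAt I (i : M)).symm (𝓝 (extChartAt I (i : M) y)) (𝓝 y) := by
        have := (continuousAt_extChartAt_symm' (I := I) hys).tendsto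
        rwa [(extChartAt I (i : M)).left_inv hys] at this
      filter_upwards [htend.eventually (hθL i (hti i) y hy),
        extChartAt_target_mem_nhds_of_isInteriorPoint hy'.1 hy'.2] with z hz hzt
      rw [(extChartAt I (i : M)).right_inv hzt] at hz
      have hsum : ∑ j : t, inner ℝ ((Pi.single i b : t → E) j)
          (θ j ((extChartAt I (i : M)).symm z)) = inner ℝ b z := by
        rw [Finset.sum_eq_single i (fun j _ hj ↦ by rw [Pi.single_eq_of_ne hj, inner_zero_left])
          (fun h ↦ absurd (Finset.mem_univ i) h), Pi.single_eq_same, hz]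
      simp only [u, F, Function.comp_apply, Pi.add_apply, inner_add_left, Finset.sum_add_distrib]
      rw [hsum, add_assoc]
    rw [hev.fderiv_eq, hev.fderiv.fderiv_eq]
    exact hb _ ⟨y, hy, rfl⟩
  have hgood : Dense (⋂ i, Good i) := dense_iInter_of_isOpen hopen hdense
  let S : Set M := ⋃ i : t, tsupport (θ i)
  have hS : IsClosed S := isClosed_iUnion_of_finite fun i ↦ isClosed_tsupport _
  have hSint : S ⊆ I.interior M := iUnion_subset fun i ↦ hθs i (hti i)
  have hFS : ∀ a, ∀ x ∉ S, F a x = f x := by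
    intro a x hx
    have : ∀ i : t, θ i x = 0 := fun i ↦
      image_eq_zero_of_notMem_tsupport fun h ↦ hx (mem_iUnion.2 ⟨i, h⟩)
    simp [F, this]
  -- The compact set `C` contains no critical point of `f`, and none of `F a` for small `a`; the
  -- critical points of `F a` then all lie in the sets `L i`, where goodness controls them.
  let C : Set M := (⋃ x ∈ t, interior (L x))ᶜ
  have hC : IsCompact C :=
    (isOpen_biUnion fun _ _ ↦ isOpen_interior).isClosed_compl.isCompact
  have hN1 : ∀ᶠ a in 𝓝 (0 : t → E), ∀ x ∈ C, ¬ IsCritPt I (F a) x := by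
    refine hC.eventually_forall_of_forall_eventually fun x hx ↦ eventually_not_isCritPt hF ?_
    rw [hF0]
    exact fun h ↦ hx (htcov h)
  have hN2 : ∀ᶠ a in 𝓝 (0 : t → E), ∀ x ∈ S, F a x ∈ Ioo (0 : ℝ) 1 := by
    refine hS.isCompact.eventually_forall_of_forall_eventually fun x hx ↦ ?_
    refine hF.continuous.continuousAt.eventually (isOpen_Ioo.mem_nhds ?_)
    change F 0 x ∈ _
    rw [hF0]
    refine h01 x fun h ↦ ?_
    rw [← I.compl_interior] at h
    exact h (hSint hx)
  obtain ⟨a, hag, ha1, ha2⟩ := hgood.inter_nhds_nonempty (hN1.and hN2)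
  have hkey : ∀ x, IsCritPt I (F a) x →
      I.IsInteriorPoint x ∧ Function.Injective (hessian I (F a) x) := by
    intro x hx
    have hxC : x ∈ ⋃ x ∈ t, interior (L x) := by
      by_contra h
      exact ha1 x h hx
    obtain ⟨c, hct, hxc⟩ := mem_iUnion₂.1 hxC
    have hxL := interior_subset hxc
    have hx' := hLs c (hti ⟨c, hct⟩) hxL
    refine ⟨hx'.2, injective_hessian hx'.1 hx'.2 (hFa a) hx ?_⟩
    exact mem_iInter.1 hag ⟨c, hct⟩ _ ⟨x, hxL, rfl⟩
      (hx.fderiv_eq_zero hx'.1 hx'.2 ((hFa a).mdifferentiableAt (by simp)))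
  refine ⟨F a, ⟨hFa a, ?_, fun x hx v hv ↦ ?_⟩, fun x hx ↦ ?_, fun x hx ↦ ?_⟩
  -- The critical set is compact and each of its points is isolated, so it is finite.
  · obtain ⟨s, -, hs⟩ := (hclosed _ (hFa a)).elim_nhds_subcover
      (fun x ↦ {y | y ≠ x → ¬ IsCritPt I (F a) y}) fun x hx ↦ eventually_nhdsWithin_iff.1
        (eventually_not_isCritPt_of_injective_hessian (hkey x hx).1 (hFa a) (hkey x hx).2)
    refine s.finite_toSet.subset fun y hy ↦ ?_
    obtain ⟨x, hxs, hyx⟩ := mem_iUnion₂.1 (hs hy)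
    have : y = x := by
      by_contra h
      exact hyx h hy
    rwa [this]
  · refine (hkey x hx).2 (ContinuousLinearMap.ext fun w ↦ ?_)
    rw [hv w, map_zero]
    rfl
  · have hxS : x ∉ S := fun h ↦ by
      rw [← I.compl_interior] at hx
      exact hx (hSint h)
    filter_upwards [hS.isOpen_compl.mem_nhds hxS] with y hy
    exact hFS a y hy
  · by_cases hxS : x ∈ S
    · exact ha2 x hxS
    · rw [hFS a x hxS]
      exact h01 x hx

end Perturbation

end MorseCobordism

/-! ### The main theorem -/

theorem mainTheorem1 (n : ℕ)
    -- the compact smooth `(n + 1)`-manifold with boundary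
    (M : Type*) [TopologicalSpace M] [T2Space M] [CompactSpace M]
    [ChartedSpace (EuclideanHalfSpace (n + 1)) M] [IsManifold (𝓡∂ (n + 1)) ∞ M]
    -- the two parts of its boundary
    (V₀ V₁ : Set M)
    [ChartedSpace (EuclideanSpace ℝ (Fin n)) V₀] [IsManifold (𝓡 n) ∞ V₀]
    [ChartedSpace (EuclideanSpace ℝ (Fin n)) V₁] [IsManifold (𝓡 n) ∞ V₁]
    (hM : MorseCobordism.IsTriad n V₀ V₁)
    -- the closed smooth `n`-manifolds
    (W₀ : Type*) [TopologicalSpace W₀] [T2Space W₀] [CompactSpace W₀]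
    [ChartedSpace (EuclideanSpace ℝ (Fin n)) W₀] [IsManifold (𝓡 n) ∞ W₀]
    (W₁ : Type*) [TopologicalSpace W₁] [T2Space W₁] [CompactSpace W₁]
    [ChartedSpace (EuclideanSpace ℝ (Fin n)) W₁] [IsManifold (𝓡 n) ∞ W₁]
    (d₀ : V₀ ≃ₘ^∞⟮𝓡 n, 𝓡 n⟯ W₀) (d₁ : V₁ ≃ₘ^∞⟮𝓡 n, 𝓡 n⟯ W₁)
    (h₀ : MorseCobordism.RiemMetric (𝓡 n) W₀) (h₁ : MorseCobordism.RiemMetric (𝓡 n) W₁)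
    (ζ : ℝ) (hζ : 1 < ζ) :
    ∃ (f : M → ℝ) (G : MorseCobordism.RiemMetric (𝓡∂ (n + 1)) M)
      (g : MorseCobordism.TensorField₂ (𝓡∂ (n + 1)) M),
      MorseCobordism.IsTriadMorse n V₀ V₁ f ∧
      g = MorseCobordism.morseMetric f G ζ ∧
      (∀ x, ¬ MorseCobordism.IsCritPt (𝓡∂ (n + 1)) f x →
        MorseCobordism.IsLorentzian (g x) ∧
        g x (MorseCobordism.grad G f x) (MorseCobordism.grad G f x) < 0) ∧
      MorseCobordism.pullback (𝓡 n) (𝓡 n) d₀.symm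
        (MorseCobordism.pullback (𝓡∂ (n + 1)) (𝓡 n) (Subtype.val : V₀ → M) g) = h₀.toTensor ∧
      MorseCobordism.pullback (𝓡 n) (𝓡 n) d₁.symm
        (MorseCobordism.pullback (𝓡∂ (n + 1)) (𝓡 n) (Subtype.val : V₁ → M) g) = h₁.toTensor := by
  obtain ⟨f₀, hf₀, hf₀0, hf₀1, hf₀int, hf₀crit⟩ :=
    MorseCobordism.exists_boundary_regular_function hM
  obtain ⟨f, hf, hfb, hfint⟩ :=
    MorseCobordism.exists_isMorse_perturbation hf₀ hf₀crit hf₀int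
  have hb₀ : ∀ x ∈ V₀, x ∈ (𝓡∂ (n + 1)).boundary M := fun x hx ↦ hM.boundary_eq ▸ Or.inl hx
  have hb₁ : ∀ x ∈ V₁, x ∈ (𝓡∂ (n + 1)).boundary M := fun x hx ↦ hM.boundary_eq ▸ Or.inr hx
  have hf0 : ∀ x ∈ V₀, f x = 0 := fun x hx ↦ (hfb x (hb₀ x hx)).self_of_nhds.trans (hf₀0 x hx)
  have hf1 : ∀ x ∈ V₁, f x = 1 := fun x hx ↦ (hfb x (hb₁ x hx)).self_of_nhds.trans (hf₀1 x hx)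
  have hcases : ∀ x, x ∈ V₀ ∨ x ∈ V₁ ∨ f x ∈ Ioo (0 : ℝ) 1 := by
    intro x
    by_cases hx : x ∈ (𝓡∂ (n + 1)).boundary M
    · rcases (hM.boundary_eq ▸ hx : x ∈ V₀ ∪ V₁) with h | h
      · exact Or.inl h
      · exact Or.inr (Or.inl h)
    · exact Or.inr (Or.inr (hfint x hx))
  have hcrit : ∀ x ∈ (𝓡∂ (n + 1)).boundary M, ¬ MorseCobordism.IsCritPt (𝓡∂ (n + 1)) f x :=
    fun x hx h ↦ hf₀crit x hx (h.congr (hfb x hx))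
  obtain ⟨ν, hν, hν1⟩ := MorseCobordism.exists_vectorField_mvfderiv_eq_one hf.smooth
    ((𝓡∂ (n + 1)).isClosed_boundary (n := ∞) (by simp)) hcrit
  obtain ⟨G, hG⟩ := MorseCobordism.exists_metric_restrictsTo hM d₀ d₁ h₀ h₁
  obtain ⟨G', hG'1, hG'⟩ := MorseCobordism.exists_metric_unit_differential hf.smooth hν G
  refine ⟨f, G', _, ⟨hf, fun x ↦ ?_, ?_, ?_, hcrit⟩, rfl,
    fun x hx ↦ MorseCobordism.morseMetric_isLorentzian f G' hζ hx,
    MorseCobordism.pullback_morseMetric hM.embedding₀.contMDiff d₀ h₀ hf.smooth hf0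
      (fun x ↦ (hG x).1) hG' (fun x hx ↦ hG'1 x (hν1 x (hb₀ x hx))) ζ,
    MorseCobordism.pullback_morseMetric hM.embedding₁.contMDiff d₁ h₁ hf.smooth hf1
      (fun x ↦ (hG x).2) hG' (fun x hx ↦ hG'1 x (hν1 x (hb₁ x hx))) ζ⟩
  · rcases hcases x with h | h | h
    · simp [hf0 x h]
    · simp [hf1 x h]
    · exact Ioo_subset_Icc_self h
  · refine Subset.antisymm (fun x hx ↦ ?_) hf0
    rcases hcases x with h | h | h
    · exact h
    · exact absurd ((hf1 x h).symm.trans hx) one_ne_zero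
    · exact absurd hx h.1.ne'
  · refine Subset.antisymm (fun x hx ↦ ?_) hf1
    rcases hcases x with h | h | h
    · exact absurd ((hf0 x h).symm.trans hx) zero_ne_one
    · exact h
    · exact absurd hx h.2.ne
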